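/- Let $R$ be a number ring, that is, a subring of a number field $K$ (a finite extension of $\mathbb{Q}$), and let $\tilde R$ be its normalization, that is, the integral closure of $R$ in its fraction field $\operatorname{Frac}(R)\subseteq K$. For a commutative ring $S$ and an ideal $I$ of $S$ of finite index write $N(I)=[S:I]$, and call $S$ super-multiplicative if $N(IJ)\geq N(I)N(J)$ for all ideals $I,J$ of $S$ such that $[S:IJ]$ is finite. Suppose that for every maximal ideal $\mathfrak m$ of $R$ the number ring $R+\mathfrak m\tilde R$ is super-multiplicative. Then every ideal of $R$ can be generated by $3$ elements. -/

import Mathlib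

namespace NumberRing

/-- The ideal norm of a commutative ring `R` is super-multiplicative: for all ideals `I`, `J` such
that `I * J` has finite index in `R`, one has `[R : IJ] ≥ [R : I] [R : J]`. -/
def SuperMultiplicative (R : Type*) [CommRing R] : Prop :=
  ∀ I J : Ideal R, Finite (R ⧸ I * J) →
    Submodule.cardQuot I * Submodule.cardQuot J ≤ Submodule.cardQuot (I * J)

/-- The normalization of a subring `R` of a field `K`: the elements of the fraction field of `R`
(the subfield of `K` generated by `R`) that are integral over `R`. -/
def normalization {K : Type*} [Field K] (R : Subring K) : Subring K :=
  (integralClosure R K).toSubring ⊓ (Subfield.closure (R : Set K)).toSubring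

theorem le_normalization {K : Type*} [Field K] (R : Subring K) : R ≤ normalization R := by
  intro x hx
  refine Subring.mem_inf.2 ⟨?_, Subfield.subset_closure hx⟩
  exact (integralClosure R K).algebraMap_mem ⟨x, hx⟩

/-- The extension `𝔪 R̃` of an ideal `𝔪` of `R` to the normalization `R̃` of `R`. -/
def extendedIdeal {K : Type*} [Field K] (R : Subring K) (m : Ideal R) :
    Ideal (normalization R) :=
  m.map (Subring.inclusion (le_normalization R))

/-- The subring `R + 𝔪 R̃` of `K`, where `R̃` is the normalization of `R`. -/
def addExtendedIdeal {K : Type*} [Field K] (R : Subring K) (m : Ideal R) : Subring K where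
  carrier := {x | ∃ r : R, ∃ a ∈ extendedIdeal R m, x = (r : K) + (a : K)}
  zero_mem' := ⟨0, 0, Ideal.zero_mem _, by simp⟩
  one_mem' := ⟨1, 0, Ideal.zero_mem _, by simp⟩
  add_mem' := by
    rintro _ _ ⟨r, a, ha, rfl⟩ ⟨s, b, hb, rfl⟩
    refine ⟨r + s, a + b, Ideal.add_mem _ ha hb, ?_⟩
    push_cast
    ring
  neg_mem' := by
    rintro _ ⟨r, a, ha, rfl⟩
    refine ⟨-r, -a, neg_mem ha, ?_⟩
    push_cast
    ring
  mul_mem' := by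
    rintro _ _ ⟨r, a, ha, rfl⟩ ⟨s, b, hb, rfl⟩
    refine ⟨r * s, (Subring.inclusion (le_normalization R) r + a) * b
      + Subring.inclusion (le_normalization R) s * a,
      Ideal.add_mem _ (Ideal.mul_mem_left _ _ hb) (Ideal.mul_mem_left _ _ ha), ?_⟩
    push_cast
    simp only [Subring.coe_inclusion]
    ring

end NumberRing

/-!
Fix a maximal ideal `m ≠ 0` of `R`, let `O` be the normalization of `R`, `M = m O`, `k = R / m`,
and `d = dim O / M` over `k`. The theorem follows from two inequalities, `dim I / m I ≤ d` for all
ideals `I ≠ 0` of `R`, and `d ≤ 3`.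

The first is proved with indices in place of multiplicities (`relIndex_smul_le_index`). As
`[I O : m I O] = [O : M]`, it says that `[m I O : m I] ≤ [I O : I]`, which would be obvious if `M`
were generated by an element of `m`. That may fail, even locally, when `k` is small; it is true at one
prime of `O` at a time, and this suffices when the two indices are split along a chain of ideals
of `O` with simple quotients (`relIndex_smul_le`).

The second inequality is where super-multiplicativity of `S = R + M` enters. Take `y ∈ M` that
generates `M / M ^ 2`. For a `k`-subspace `U` of `O / M` with preimage `W` in `O`, the set
`y W + M ^ 2` is an ideal of `S` whose index is determined by `dim U`. The norm inequality for two
of these ideals gives `dim (U₁ U₂) < dim U₁ + dim U₂` whenever `1 ∈ U₁`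
(`finrank_mul_lt_of_superMultiplicative`). If `d ≥ 4`, then `O / M` contains `x`, `z` such that
`1, x, z, x z` are linearly independent (`exists_linearIndependent_quadruple`), which violates
this for `U₁ = ⟨1, x⟩` and `U₂ = ⟨1, z⟩`. The only finite algebras without such `x` and `z` that
have dimension at least four are `k ⊕ N` with `N ^ 2 = 0`, and they are not quotients of Dedekind
domains, as the ideal `N` would be principal.

The passage from `dim I / m I ≤ 3` for all `m` to three generators of `I` is the usual choice of
generators by the Chinese remainder theorem and Nakayama's lemma (`exists_eq_span_triple`); no
extra generator is needed because `R` has dimension one.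

The arithmetic input is that nonzero ideals of subrings of number fields have finite index
(`finite_quotient_of_ne_bot`), that `O` is a Dedekind domain, and that the conductor of `R` in `O`
is nonzero (`exists_conductor`).
-/

namespace NumberRing

/-! ### Finite-dimensional algebras without independent quadruples `1, x, z, x z` -/

section FiniteAlgebra

variable {k V : Type*} [Field k] [CommRing V] [Algebra k V]

theorem mem_span_of_not_linearIndependent [Nontrivial V]
    (H : ∀ x z : V, ¬ LinearIndependent k ![x * z, z, x, 1]) {x z : V}
    (hx : x ∉ Submodule.span k {(1 : V)}) (hz : z ∉ Submodule.span k {x, 1}) :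
    x * z ∈ Submodule.span k {z, x, 1} := by
  by_contra h
  refine H x z (linearIndependent_finCons.2 ⟨linearIndependent_finCons.2
    ⟨linearIndependent_finCons.2 ⟨?_, ?_⟩, ?_⟩, ?_⟩)
  · simp
  · simpa using hx
  · simpa [Set.pair_comm] using hz
  · simpa [Set.insert_comm, Set.pair_comm] using h

theorem exists_notMem_span_triple [FiniteDimensional k V] (hd : 4 ≤ Module.finrank k V)
    (a b c : V) : ∃ w, w ∉ Submodule.span k {a, b, c} := by
  classical
  by_contra! h
  have h1 : Submodule.span k (({a, b, c} : Finset V) : Set V) = ⊤ := by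
    rw [eq_top_iff]; intro w _; simpa using h w
  have h2 := finrank_span_finset_le_card (R := k) ({a, b, c} : Finset V)
  rw [Set.finrank, h1, finrank_top] at h2
  have := Finset.card_le_three (a := a) (b := b) (c := c)
  omega

/-- If no `1, x, z, x z` are independent, then multiplication by `x ∉ k` acts on `V / ⟨1, x⟩` as a
scalar `c`, because every vector is an eigenvector up to `⟨1, x⟩`. Hence `u = x - c` satisfies
`u V ⊆ ⟨1, u⟩`, and even `u V ⊆ k u` since `u` cannot be a unit. -/
theorem exists_eq_smul_of_not_linearIndependent [FiniteDimensional k V]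
    (H : ∀ x z : V, ¬ LinearIndependent k ![x * z, z, x, 1])
    (hd : 4 ≤ Module.finrank k V) {x : V} (hx : x ∉ Submodule.span k {(1 : V)}) :
    ∃ c : k, ∀ v : V, ∃ b : k,
      (x - algebraMap k V c) * v = b • (x - algebraMap k V c) := by
  have : Nontrivial V := by
    apply Module.nontrivial_of_finrank_pos (R := k); omega
  have key : ∀ z, z ∉ Submodule.span k {x, 1} →
      ∃ c : k, x * z - c • z ∈ Submodule.span k {x, 1} := by
    intro z hz
    obtain ⟨c, y, hy, h⟩ := Submodule.mem_span_insert.1 (mem_span_of_not_linearIndependent H hx hz)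
    exact ⟨c, by rw [h]; simpa using hy⟩
  -- the eigenvalues of independent vectors agree, by looking at their sum
  have uniq : ∀ (z w : V) (c c' : k), z ∉ Submodule.span k {x, 1} → w ∉ Submodule.span k {z, x, 1} →
      x * z - c • z ∈ Submodule.span k {x, 1} → x * w - c' • w ∈ Submodule.span k {x, 1} →
      c' = c := by
    intro z w c c' hz hw h1 h2
    have hle : Submodule.span k {x, 1} ≤ Submodule.span k {z, x, (1 : V)} :=
      Submodule.span_mono (Set.subset_insert _ _)
    have hzm : z ∈ Submodule.span k {z, x, (1 : V)} := Submodule.subset_span (by simp)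
    obtain ⟨e, he⟩ := key (z + w) (by
      intro h
      apply hw
      simpa using sub_mem (hle h) hzm)
    have h3 := sub_mem (sub_mem he h1) h2
    have e1 : x * (z + w) - e • (z + w) - (x * z - c • z) - (x * w - c' • w)
        = (c - e) • z + (c' - e) • w := by
      simp only [sub_smul, smul_add]; ring
    rw [e1] at h3
    have h4 : c' = e := by
      by_contra hne
      apply hw
      have : (c' - e) • w ∈ Submodule.span k {z, x, (1 : V)} := by
        simpa using sub_mem (hle h3) (Submodule.smul_mem _ (c - e) hzm)
      exact (Submodule.smul_mem_iff _ (sub_ne_zero.2 hne)).1 this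
    rw [h4, sub_self, zero_smul, add_zero] at h3
    by_contra hne
    rw [h4] at hne
    exact hz ((Submodule.smul_mem_iff _ (sub_ne_zero.2 (Ne.symm hne))).1 h3)
  obtain ⟨z, hz⟩ : ∃ z, z ∉ Submodule.span k {x, (1 : V)} := by
    simpa using exists_notMem_span_triple hd x x 1
  obtain ⟨w, hw⟩ := exists_notMem_span_triple hd z x 1
  obtain ⟨c, hc⟩ := key z hz
  have hle : Submodule.span k {x, 1} ≤ Submodule.span k {z, x, (1 : V)} :=
    Submodule.span_mono (Set.subset_insert _ _)
  have out : ∀ v, v ∉ Submodule.span k {z, x, (1 : V)} →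
      x * v - c • v ∈ Submodule.span k {x, 1} := by
    intro v hv
    obtain ⟨c', hc'⟩ := key v (fun h => hv (hle h))
    rwa [uniq z v c c' hz hv hc hc'] at hc'
  -- the complement of a proper subspace spans the whole space
  have all : ∀ v, x * v - c • v ∈ Submodule.span k {x, 1} := by
    intro v
    by_cases hv : v ∈ Submodule.span k {z, x, (1 : V)}
    · have h1 := out (v + w) (fun h => hw (by simpa using sub_mem h hv))
      have h2 := sub_mem h1 (out w hw)
      convert h2 using 1
      simp only [smul_add]; ring
    · exact out v hv
  refine ⟨c, fun v => ?_⟩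
  set u := x - algebraMap k V c with hu
  have hu2 : ∀ v, ∃ a b : k, u * v = a • (1 : V) + b • u := by
    intro v
    obtain ⟨p, q, hpq⟩ := Submodule.mem_span_pair.1 (all v)
    refine ⟨q + p * c, p, ?_⟩
    have : u * v = x * v - c • v := by rw [hu, sub_mul, Algebra.smul_def]
    rw [this, ← hpq, hu]
    simp only [Algebra.smul_def, map_add, map_mul]
    ring
  obtain ⟨a, b, hab⟩ := hu2 v
  by_cases ha : a = 0
  · exact ⟨b, by simpa [ha] using hab⟩
  -- otherwise `u` is a unit, so that `V = u V` has dimension at most two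
  exfalso
  have hunit : u * (a⁻¹ • (v - algebraMap k V b)) = 1 := by
    rw [mul_smul_comm, mul_sub, hab, Algebra.smul_def b, mul_comm u, add_sub_cancel_right,
      inv_smul_smul₀ ha]
  obtain ⟨y, hy⟩ := exists_notMem_span_triple hd u u 1
  apply hy
  obtain ⟨p, q, hpq⟩ := hu2 ((a⁻¹ • (v - algebraMap k V b)) * y)
  rw [← mul_assoc, hunit, one_mul] at hpq
  rw [hpq]
  exact add_mem (Submodule.smul_mem _ _ (Submodule.subset_span (by simp)))
    (Submodule.smul_mem _ _ (Submodule.subset_span (by simp)))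

/-- Without an independent quadruple `1, x, z, x z`, the algebra would be `k ⊕ N` with `N ^ 2 = 0`
and `dim N ≥ 3`. This is excluded by the assumption that the nilradical is principal; it does occur
for general algebras. -/
theorem exists_linearIndependent_quadruple [FiniteDimensional k V]
    (hd : 4 ≤ Module.finrank k V) (hP : (nilradical V).IsPrincipal) :
    ∃ x z : V, LinearIndependent k ![x * z, z, x, 1] := by
  by_contra! H
  have : Nontrivial V := by
    apply Module.nontrivial_of_finrank_pos (R := k); omega
  have h1mem : ∀ c : k, algebraMap k V c ∈ Submodule.span k {(1 : V)} := fun c =>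
    Submodule.mem_span_singleton.2 ⟨c, by rw [Algebra.smul_def, mul_one]⟩
  let Q : V → Prop := fun u => ∀ v, ∃ b : k, u * v = b • u
  have hQ : ∀ x : V, x ∉ Submodule.span k {(1 : V)} → ∃ c, Q (x - algebraMap k V c) :=
    fun x hx => exists_eq_smul_of_not_linearIndependent H hd hx
  -- for independent `u`, `z` with `Q u` and `Q z`, the product `u z` lies in `k u ∩ k z = 0`
  have hQ0 : ∀ u z, Q u → Q z → u ≠ 0 → z ∉ Submodule.span k {u} → u * z = 0 := by
    intro u z hu hz hu0 hzu
    obtain ⟨b, hb⟩ := hu z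
    obtain ⟨b', hb'⟩ := hz u
    by_cases h : b' = 0
    · rw [mul_comm, hb', h, zero_smul]
    · exfalso
      apply hzu
      rw [← Submodule.smul_mem_iff _ h, ← hb', mul_comm, hb]
      exact Submodule.smul_mem _ _ (Submodule.mem_span_singleton_self u)
  -- comparing `u`, `z`, `w` with the translate `s` of `u + z` that satisfies `Q`
  have hsq : ∀ u, Q u → u ∉ Submodule.span k {(1 : V)} → u * u = 0 := by
    intro u hu hu1
    have hu0 : u ≠ 0 := fun h => hu1 (h ▸ zero_mem _)
    obtain ⟨z₀, hz₀⟩ : ∃ z, z ∉ Submodule.span k {u, (1 : V)} := by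
      simpa using exists_notMem_span_triple hd u u 1
    obtain ⟨c, hz⟩ := hQ z₀ (fun h => hz₀ (Submodule.span_mono (by simp) h))
    set z := z₀ - algebraMap k V c with hzdef
    have hz1 : z ∉ Submodule.span k {u, (1 : V)} := by
      intro h
      apply hz₀
      have := add_mem h (Submodule.span_mono (by simp) (h1mem c) :
        algebraMap k V c ∈ Submodule.span k {u, (1 : V)})
      simpa [hzdef] using this
    obtain ⟨w₀, hw₀⟩ := exists_notMem_span_triple hd z u 1
    obtain ⟨e, hw⟩ := hQ w₀ (fun h => hw₀ (Submodule.span_mono (by simp) h))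
    set w := w₀ - algebraMap k V e with hwdef
    have hw1 : w ∉ Submodule.span k {z, u, (1 : V)} := by
      intro h
      apply hw₀
      have := add_mem h (Submodule.span_mono (by simp) (h1mem e) :
        algebraMap k V e ∈ Submodule.span k {z, u, (1 : V)})
      simpa [hwdef] using this
    have hum : u ∈ Submodule.span k {u, (1 : V)} := Submodule.subset_span (by simp)
    obtain ⟨l, hs⟩ := hQ (u + z) (fun h => hz1 (by
      have := sub_mem (Submodule.span_mono (by simp) h : u + z ∈ Submodule.span k {u, (1 : V)}) hum
      simpa using this))
    set s := u + z - algebraMap k V l with hsdef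
    have hl1 : algebraMap k V l ∈ Submodule.span k {u, (1 : V)} :=
      Submodule.span_mono (by simp) (h1mem l)
    have hs1 : s ∉ Submodule.span k {u, (1 : V)} := by
      intro h
      apply hz1
      have := sub_mem (add_mem h hl1) hum
      simpa [hsdef] using this
    have hz0 : z ≠ 0 := fun h => hz1 (h ▸ zero_mem _)
    have hs0 : s ≠ 0 := fun h => hs1 (h ▸ zero_mem _)
    have hw0 : w ≠ 0 := fun h => hw1 (h ▸ zero_mem _)
    have huz := hQ0 u z hu hz hu0 (fun h => hz1 (Submodule.span_mono (by simp) h))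
    have huw := hQ0 u w hu hw hu0 (fun h => hw1 (Submodule.span_mono (by simp) h))
    have hzw := hQ0 z w hz hw hz0 (fun h => hw1 (Submodule.span_mono (by simp) h))
    have hus := hQ0 u s hu hs hu0 (fun h => hs1 (Submodule.span_mono (by simp) h))
    have hle : Submodule.span k {u, (1 : V)} ≤ Submodule.span k {z, u, 1} :=
      Submodule.span_mono (Set.subset_insert _ _)
    have hsm : s ∈ Submodule.span k {z, u, (1 : V)} :=
      sub_mem (add_mem (hle hum) (Submodule.subset_span (by simp))) (hle hl1)
    have hsw := hQ0 s w hs hw hs0 (fun h => hw1 ((Submodule.span_le.2 (by simpa using hsm)) h))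
    have hlw : l • w = 0 := by
      rw [Algebra.smul_def]
      linear_combination huw + hzw - hsw
    have hl : l = 0 := (smul_eq_zero.1 hlw).resolve_right hw0
    rw [hsdef, hl, map_zero] at hus
    linear_combination hus - huz
  -- every element is a constant plus a nilpotent element satisfying `Q`
  have hdec : ∀ x : V, ∃ c : k, Q (x - algebraMap k V c) ∧
      IsNilpotent (x - algebraMap k V c) := by
    intro x
    by_cases hx : x ∈ Submodule.span k {(1 : V)}
    · obtain ⟨c, rfl⟩ := Submodule.mem_span_singleton.1 hx
      refine ⟨c, ?_⟩
      rw [Algebra.smul_def, mul_one, sub_self]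
      exact ⟨fun v => ⟨0, by simp⟩, IsNilpotent.zero⟩
    · obtain ⟨c, hc⟩ := hQ x hx
      refine ⟨c, hc, 2, ?_⟩
      rw [sq]
      refine hsq _ hc (fun h => hx ?_)
      simpa using add_mem h (h1mem c)
  -- a generator `t` of the nilradical satisfies `Q t`, so that `V` is spanned by `t` and `1`
  obtain ⟨t, ht⟩ := hP
  have htn : IsNilpotent t := by
    rw [← mem_nilradical, ht]; exact Submodule.mem_span_singleton_self t
  obtain ⟨y, hy⟩ := exists_notMem_span_triple hd t t 1
  apply hy
  have htQ : Q t := by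
    obtain ⟨c, hc, hn⟩ := hdec t
    have hcn : IsNilpotent (algebraMap k V c) := by
      have := (Commute.all t (t - algebraMap k V c)).isNilpotent_sub htn hn
      simpa using this
    have : c = 0 := by
      have := (IsNilpotent.map_iff (algebraMap k V).injective).1 hcn
      exact this.eq_zero
    simpa [this] using hc
  obtain ⟨c, -, hn⟩ := hdec y
  rw [← mem_nilradical, ht] at hn
  obtain ⟨v, hv⟩ := Submodule.mem_span_singleton.1 hn
  obtain ⟨b, hb⟩ := htQ v
  have : y = b • t + c • (1 : V) := by
    rw [← hb, Algebra.smul_def, mul_one]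
    rw [smul_eq_mul] at hv
    linear_combination -hv
  rw [this]
  exact add_mem (Submodule.smul_mem _ _ (Submodule.subset_span (by simp)))
    (Submodule.smul_mem _ _ (Submodule.subset_span (by simp)))

end FiniteAlgebra

/-! ### Indices of additive subgroups -/

section Index

/-- If `f` induces a surjection `B / N → B' / N'`, then the index does not increase. -/
theorem relIndex_le_of_le_map_sup {G H : Type*} [AddCommGroup G] [AddCommGroup H] (f : G →+ H)
    {N B : AddSubgroup G} {N' B' : AddSubgroup H} (hN : N ≤ N'.comap f)
    (hB : B' ≤ B.map f ⊔ N') (h0 : N.relIndex B ≠ 0) :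
    N'.relIndex B' ≤ N.relIndex B := by
  have h1 : N'.relIndex (B.map f ⊔ N') = (N'.comap f).relIndex B := by
    rw [AddSubgroup.relIndex_sup_right, AddSubgroup.relIndex_comap]
  have h2 : N'.relIndex (B.map f ⊔ N') ≤ N.relIndex B :=
    h1 ▸ AddSubgroup.relIndex_le_of_le_left hN h0
  have h3 : N'.relIndex (B.map f ⊔ N') ≠ 0 := by
    rw [h1]; exact fun h => h0 (AddSubgroup.relIndex_eq_zero_of_le_left hN h)
  exact (AddSubgroup.relIndex_le_of_le_right hB h3).trans h2

theorem relIndex_ne_zero_of_finite {O : Type*} [CommRing O] {J : Ideal O} [Finite (O ⧸ J)]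
    {N : AddSubgroup O} (h : J.toAddSubgroup ≤ N) (B : AddSubgroup O) : N.relIndex B ≠ 0 := by
  have : J.toAddSubgroup.index ≠ 0 := AddSubgroup.index_ne_zero_iff_finite.2 ‹_›
  have h2 : J.toAddSubgroup.relIndex ⊤ ≠ 0 := by rwa [AddSubgroup.relIndex_top_right]
  intro h3
  exact h2 (AddSubgroup.relIndex_eq_zero_of_le_right le_top
    (AddSubgroup.relIndex_eq_zero_of_le_left h h3))

theorem relIndex_eq_relIndex_mul_relIndex_sup {G : Type*} [AddCommGroup G]
    {N L L' : AddSubgroup G} (hN : N ≤ L) (hL' : L' ≤ L) :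
    N.relIndex L = N.relIndex L' * (N ⊔ L').relIndex L := by
  rw [← AddSubgroup.relIndex_mul_relIndex N (N ⊔ L') L le_sup_left (sup_le hN hL'),
    AddSubgroup.relIndex_sup_left]

end Index

/-! ### The bound `[I : m I] ≤ [O : m O]` -/

section Extension

variable {R O : Type*} [CommRing R] [CommRing O] [IsDedekindDomain O] [Algebra R O]

/-- `m O / P m O` is one-dimensional over `O / P`, and it is generated by the image of `m`. -/
theorem exists_map_eq_span_sup_mul (m : Ideal R) (hm : m.map (algebraMap R O) ≠ ⊥)
    {P : Ideal O} (hP : P.IsPrime) (hP0 : P ≠ ⊥) :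
    ∃ y ∈ m, m.map (algebraMap R O) =
      Ideal.span {algebraMap R O y} ⊔ P * m.map (algebraMap R O) := by
  set M := m.map (algebraMap R O) with hM
  have hmax := hP.isMaximal hP0
  obtain ⟨y, hy, hyP⟩ : ∃ y ∈ m, algebraMap R O y ∉ P * M := by
    by_contra! h
    have h1 : M ≤ P * M := Ideal.map_le_iff_le_comap.2 h
    have h2 : P * M ∣ 1 * M := by rw [one_mul]; exact Ideal.dvd_iff_le.2 h1
    rw [mul_dvd_mul_iff_right hm] at h2
    exact hP.ne_top (Ideal.isUnit_iff.1 (isUnit_of_dvd_one h2))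
  refine ⟨y, hy, ?_⟩
  have hle : Ideal.span {algebraMap R O y} ⊔ P * M ≤ M :=
    sup_le ((Ideal.span_singleton_le_iff_mem _).2 (Ideal.mem_map_of_mem _ hy)) Ideal.mul_le_right
  obtain ⟨D, hD⟩ := Ideal.dvd_iff_le.2 hle
  have h3 : P ≤ D := by
    have : M * D ∣ M * P := by
      rw [← hD, mul_comm M P]; exact Ideal.dvd_iff_le.2 le_sup_right
    exact Ideal.dvd_iff_le.1 ((mul_dvd_mul_iff_left hm).1 this)
  rcases eq_or_ne D ⊤ with h | h
  · rw [hD, h, Ideal.mul_top]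
  · exfalso
    apply hyP
    rw [hmax.eq_of_le h h3, mul_comm, ← hD]
    exact Ideal.mem_sup_left (Ideal.mem_span_singleton_self _)

/-- If `L` is an ideal of `O` and `N ⊆ L` an `R`-submodule of finite index, then
`[m L : m N] ≤ [L : N]`. If `m O` were generated by an element `y` of `m`, this would follow from
`y N ⊆ m N`. In general there is such a `y` modulo `P m O` for each prime `P` of `O`, with `y`
depending on `P`; so the indices are compared along a chain `L ⊇ P L ⊇ P P' L ⊇ ⋯` that ends inside
`N`, by induction on the factors of an ideal `A` with `A L ⊆ N`. -/
theorem relIndex_smul_le (hfin : ∀ J : Ideal O, J ≠ ⊥ → Finite (O ⧸ J)) (m : Ideal R)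
    (hm : m.map (algebraMap R O) ≠ ⊥) (A : Ideal O) :
    A ≠ ⊥ → ∀ (L : Ideal O) (N : Submodule R O), L ≠ ⊥ → N ≤ L.restrictScalars R →
      (A * L).restrictScalars R ≤ N →
      (m • N).toAddSubgroup.relIndex (m.map (algebraMap R O) * L).toAddSubgroup ≤
        N.toAddSubgroup.relIndex L.toAddSubgroup := by
  have hres : ∀ L : Ideal O, m • L.restrictScalars R =
      (m.map (algebraMap R O) * L).restrictScalars R := fun L =>
    (Ideal.smul_restrictScalars m L).symm
  induction A using UniqueFactorizationMonoid.induction_on_prime with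
  | h₁ => exact fun h => absurd rfl h
  | h₂ A hA =>
    intro _ L N _ hNL hAN
    rw [Ideal.isUnit_iff.1 hA, Ideal.top_mul] at hAN
    rw [le_antisymm hNL hAN, hres]
    exact le_of_eq ((AddSubgroup.relIndex_self _).trans (AddSubgroup.relIndex_self _).symm)
  | h₃ A P hA hP ih =>
    intro _ L N hL hNL hAN
    have hP0 : P ≠ ⊥ := hP.ne_zero
    have hPp : P.IsPrime := Ideal.isPrime_of_prime hP
    obtain ⟨y, hym, hy⟩ := exists_map_eq_span_sup_mul m hm hPp hP0
    set M := m.map (algebraMap R O) with hM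
    have hAL : (A * (P * L)).restrictScalars R ≤ N := by
      rw [← mul_assoc, mul_comm A P]; exact hAN
    have hle : (A * (P * L)).restrictScalars R ≤ N ⊓ (P * L).restrictScalars R :=
      le_inf hAL (fun x hx => Ideal.mul_le_right hx)
    have hPL : P * L ≠ ⊥ := mul_ne_zero hP0 hL
    have hAPL : A * (P * L) ≠ ⊥ := mul_ne_zero hA hPL
    have := hfin _ hAPL
    have hMAPL : M * (A * (P * L)) ≠ ⊥ := mul_ne_zero hm hAPL
    have := hfin _ hMAPL
    have hmN : ∀ N' : Submodule R O, (A * (P * L)).restrictScalars R ≤ N' →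
        (M * (A * (P * L))).toAddSubgroup ≤ (m • N').toAddSubgroup := by
      intro N' hN' x hx
      have : x ∈ m • (A * (P * L)).restrictScalars R := by rw [hres]; exact hx
      exact smul_mono_right m hN' this
    have hN0 : (A * (P * L)).toAddSubgroup ≤ N.toAddSubgroup := hAL
    have key := ih hA (P * L) (N ⊓ (P * L).restrictScalars R) hPL inf_le_right hle
    -- splitting both indices along `P L` and `M P L`
    rw [relIndex_eq_relIndex_mul_relIndex_sup (N := N.toAddSubgroup)
        (L' := (P * L).toAddSubgroup) hNL (fun x hx => Ideal.mul_le_right hx),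
      relIndex_eq_relIndex_mul_relIndex_sup (N := (m • N).toAddSubgroup)
        (L' := (M * (P * L)).toAddSubgroup) ?_
        (fun x hx => Ideal.mul_mono_right Ideal.mul_le_right hx)]
    swap
    · intro x hx
      have : x ∈ m • L.restrictScalars R := smul_mono_right m hNL hx
      rw [hres] at this
      exact this
    have key' : (N ⊓ (P * L).restrictScalars R).toAddSubgroup.relIndex (P * L).toAddSubgroup ≤
        N.toAddSubgroup.relIndex (P * L).toAddSubgroup :=
      (AddSubgroup.inf_relIndex_right N.toAddSubgroup (P * L).toAddSubgroup).le
    replace key := key.trans key'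
    refine Nat.mul_le_mul ?_ ?_
    · refine le_trans (AddSubgroup.relIndex_le_of_le_left ?_ ?_) key
      · have : m • (N ⊓ (P * L).restrictScalars R) ≤ m • N := smul_mono_right m inf_le_left
        exact this
      · exact relIndex_ne_zero_of_finite (hmN _ hle) _
    · refine relIndex_le_of_le_map_sup (AddMonoidHom.mulLeft (algebraMap R O y))
        (sup_le ?_ ?_) ?_ ?_
      · intro x hx
        refine AddSubgroup.mem_sup_left (T := (M * (P * L)).toAddSubgroup) ?_
        change algebraMap R O y * x ∈ m • N
        rw [← Algebra.smul_def]
        exact Submodule.smul_mem_smul hym hx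
      · intro x hx
        refine AddSubgroup.mem_sup_right (T := (M * (P * L)).toAddSubgroup) ?_
        exact Ideal.mul_mem_mul (Ideal.mem_map_of_mem _ hym) hx
      · intro x hx
        have hx' : x ∈ M * L := hx
        rw [hy, Ideal.sup_mul] at hx'
        obtain ⟨a, ha, b, hb, rfl⟩ := Submodule.mem_sup.1 hx'
        obtain ⟨l, hl, rfl⟩ := Ideal.mem_span_singleton_mul.1 ha
        refine AddSubgroup.add_mem_sup ⟨l, hl, rfl⟩
          (AddSubgroup.mem_sup_right (T := (M * (P * L)).toAddSubgroup) ?_)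
        rw [mul_comm P, mul_assoc] at hb
        exact hb
      · exact relIndex_ne_zero_of_finite (hN0.trans le_sup_left) _

/-- `[I : m I] ≤ [O : m O]`: for `L = I O` this is the inequality `[m L : m I] ≤ [L : I]`, because
`[L : m L] = [O : m O]`. The element `c` lies in the conductor of `R` in `O`. -/
theorem relIndex_smul_le_index (hfin : ∀ J : Ideal O, J ≠ ⊥ → Finite (O ⧸ J)) (m : Ideal R)
    (hm : m.map (algebraMap R O) ≠ ⊥)
    {c : R} (hc0 : algebraMap R O c ≠ 0)
    (hc : ∀ x : O, ∃ r : R, algebraMap R O r = algebraMap R O c * x)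
    (hinj : Function.Injective (algebraMap R O)) (I : Ideal R) (hI : I ≠ ⊥) :
    (m * I).toAddSubgroup.relIndex I.toAddSubgroup ≠ 0 ∧
    (m * I).toAddSubgroup.relIndex I.toAddSubgroup ≤
      (m.map (algebraMap R O)).toAddSubgroup.index := by
  set M := m.map (algebraMap R O) with hM
  set L := I.map (algebraMap R O) with hL
  let N : Submodule R O := Submodule.map (Algebra.linearMap R O) I
  have hL0 : L ≠ ⊥ := by
    obtain ⟨x, hx, hx0⟩ := Submodule.exists_mem_ne_zero_of_ne_bot hI
    intro h
    have : algebraMap R O x ∈ L := Ideal.mem_map_of_mem _ hx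
    rw [h, Ideal.mem_bot] at this
    exact hx0 (hinj (by rw [this, map_zero]))
  have hA0 : Ideal.span {algebraMap R O c} ≠ ⊥ := by simpa using hc0
  have hNL : N ≤ L.restrictScalars R := by
    rintro _ ⟨x, hx, rfl⟩
    exact Ideal.mem_map_of_mem _ hx
  have hcL : (Ideal.span {algebraMap R O c} * L).restrictScalars R ≤ N := by
    intro x hx
    obtain ⟨l, hl, rfl⟩ := Ideal.mem_span_singleton_mul.1 hx
    have hl' : l ∈ I • (⊤ : Submodule R O) := by rw [Ideal.smul_top_eq_map]; exact hl
    clear hx hl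
    induction hl' using Submodule.smul_induction_on' with
    | smul r hr n hn =>
      obtain ⟨s, hs⟩ := hc n
      refine ⟨r * s, I.mul_mem_right _ hr, ?_⟩
      rw [Algebra.linearMap_apply, map_mul, hs, Algebra.smul_def]
      ring
    | add x hx y hy h1 h2 =>
      rw [mul_add]
      exact add_mem h1 h2
  have h1 := relIndex_smul_le hfin m hm _ hA0 L N hL0 hNL hcL
  rw [← hM] at h1
  have hCL0 : Ideal.span {algebraMap R O c} * L ≠ ⊥ := mul_ne_zero hA0 hL0
  have := hfin _ hCL0
  have := hfin _ (mul_ne_zero hm hCL0 : M * (Ideal.span {algebraMap R O c} * L) ≠ ⊥)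
  have := hfin _ hm
  have hmN : (M * (Ideal.span {algebraMap R O c} * L)).toAddSubgroup ≤ (m • N).toAddSubgroup := by
    intro x hx
    refine smul_mono_right m hcL ?_
    rw [← Ideal.smul_restrictScalars]
    exact hx
  have hmNN : (m • N).toAddSubgroup ≤ N.toAddSubgroup := fun x hx => Submodule.smul_le_right hx
  have hmNML : (m • N).toAddSubgroup ≤ (M * L).toAddSubgroup := by
    intro x hx
    have : x ∈ m • L.restrictScalars R := smul_mono_right m hNL hx
    rw [← Ideal.smul_restrictScalars] at this
    exact this
  have hML : (M * L).toAddSubgroup ≤ L.toAddSubgroup := fun x hx => Ideal.mul_le_right hx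
  -- `L / M L` is a quotient of `O / M`, as `L` is principal modulo `M L`
  have h2 : (M * L).toAddSubgroup.relIndex L.toAddSubgroup ≤ M.toAddSubgroup.index := by
    rw [← AddSubgroup.relIndex_top_right]
    obtain ⟨l, hl⟩ := IsDedekindDomain.exists_sup_span_eq (I := M * L) (J := L) Ideal.mul_le_right
      (mul_ne_zero hm hL0)
    have hlL : l ∈ L := hl ▸ Ideal.mem_sup_right (Ideal.mem_span_singleton_self l)
    refine relIndex_le_of_le_map_sup (AddMonoidHom.mulLeft l) ?_ ?_
      (relIndex_ne_zero_of_finite le_rfl _)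
    · intro x hx
      change l * x ∈ M * L
      rw [mul_comm l]
      exact Ideal.mul_mem_mul (show x ∈ M from hx) hlL
    · intro x hx
      have hx' : x ∈ L := hx
      rw [← hl] at hx'
      obtain ⟨a, ha, b, hb, rfl⟩ := Submodule.mem_sup.1 hx'
      obtain ⟨e, rfl⟩ := Ideal.mem_span_singleton'.1 hb
      rw [add_comm, mul_comm e l]
      exact AddSubgroup.add_mem_sup ⟨e, trivial, rfl⟩ ha
  have e1 := AddSubgroup.relIndex_mul_relIndex _ _ _ hmNN
    (show N.toAddSubgroup ≤ L.toAddSubgroup from hNL)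
  have e2 := AddSubgroup.relIndex_mul_relIndex _ _ _ hmNML hML
  have hNL0 : N.toAddSubgroup.relIndex L.toAddSubgroup ≠ 0 :=
    relIndex_ne_zero_of_finite (J := Ideal.span {algebraMap R O c} * L) hcL _
  have e3 : (m * I).toAddSubgroup.relIndex I.toAddSubgroup =
      (m • N).toAddSubgroup.relIndex N.toAddSubgroup := by
    have hN : m • N = Submodule.map (Algebra.linearMap R O) (m * I) := by
      rw [← smul_eq_mul, Submodule.map_smul'']
    rw [hN]
    exact (AddSubgroup.relIndex_map_map_of_injective _ _
      (f := (Algebra.linearMap R O).toAddMonoidHom) hinj).symm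
  rw [e3]
  refine ⟨relIndex_ne_zero_of_finite hmN _, ?_⟩
  refine Nat.le_of_mul_le_mul_right ?_ (Nat.pos_of_ne_zero hNL0)
  rw [e1, ← e2, mul_comm (M.toAddSubgroup.index)]
  exact Nat.mul_le_mul h1 h2

end Extension

/-! ### Super-multiplicativity of `R + m O` -/

section SuperMultiplicative

variable {R O S : Type*} [CommRing R] [CommRing O] [Algebra R O] [CommRing S]

/-- The preimage in `O` of a subspace of the `R ⧸ m`-algebra `O ⧸ m O`. -/
def preimageSubspace (m : Ideal R)
    (U : Submodule (R ⧸ m) (O ⧸ m.map (algebraMap R O))) : AddSubgroup O :=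
  U.toAddSubgroup.comap (Ideal.Quotient.mk (m.map (algebraMap R O))).toAddMonoidHom

theorem mem_preimageSubspace {m : Ideal R}
    {U : Submodule (R ⧸ m) (O ⧸ m.map (algebraMap R O))} {x : O} :
    x ∈ preimageSubspace m U ↔ Ideal.Quotient.mk (m.map (algebraMap R O)) x ∈ U := Iff.rfl

theorem index_preimageSubspace_mul_pow (m : Ideal R) [m.IsMaximal] [Finite (R ⧸ m)]
    [Finite (O ⧸ m.map (algebraMap R O))]
    (U : Submodule (R ⧸ m) (O ⧸ m.map (algebraMap R O))) :
    (preimageSubspace m U).index * Nat.card (R ⧸ m) ^ Module.finrank (R ⧸ m) U =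
      Nat.card (O ⧸ m.map (algebraMap R O)) := by
  let := Ideal.Quotient.field m
  have h1 : (preimageSubspace m U).index = U.toAddSubgroup.index :=
    AddSubgroup.index_comap_of_surjective _ Ideal.Quotient.mk_surjective
  rw [h1, ← Module.natCard_eq_pow_finrank]
  exact AddSubgroup.index_mul_card U.toAddSubgroup

variable [IsDedekindDomain O]

/-- If `y` generates `M / M ^ 2`, then multiplication by `y` is injective from `O / M` to
`M / M ^ 2`. -/
theorem mem_of_mul_mem_sq {M : Ideal O} (hM : M ≠ ⊥) {y : O} (hy : M = M ^ 2 ⊔ Ideal.span {y})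
    {z : O} (h : y * z ∈ M ^ 2) : z ∈ M := by
  have h1 : M * Ideal.span {z} ≤ M * M := by
    conv_lhs => rw [hy, Ideal.sup_mul, Ideal.span_singleton_mul_span_singleton]
    rw [← sq]
    exact sup_le Ideal.mul_le_left ((Ideal.span_singleton_le_iff_mem _).2 h)
  have h2 := Ideal.dvd_iff_le.2 h1
  rw [mul_dvd_mul_iff_left hM] at h2
  exact (Ideal.span_singleton_le_iff_mem _).1 (Ideal.dvd_iff_le.1 h2)

/-- Let `S` be the subring `R + m O` of `O`, embedded by `f`. If `S` is super-multiplicative, then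
`dim (U₁ U₂) < dim U₁ + dim U₂` for subspaces of `O / m O` with `1 ∈ U₁`: for `y` generating
`M = m O` modulo `M ^ 2`, the norm inequality is applied to the ideals `y W₁ + M ^ 2` and
`y W₂ + M ^ 2` of `S`, where `Wᵢ` is the preimage of `Uᵢ`; their product contains
`y ^ 2 W + M ^ 3`, where `W` is the preimage of `U₁ U₂`. -/
theorem finrank_mul_lt_of_superMultiplicative
    (hfin : ∀ J : Ideal O, J ≠ ⊥ → Finite (O ⧸ J))
    (m : Ideal R) [m.IsMaximal] [Finite (R ⧸ m)]
    (hm : m.map (algebraMap R O) ≠ ⊥) (hm1 : m.map (algebraMap R O) ≠ ⊤)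
    (f : S →+* O) (hf : Function.Injective f)
    (hrange : ∀ x : O, x ∈ f.range ↔
      ∃ r : R, ∃ a ∈ m.map (algebraMap R O), x = algebraMap R O r + a)
    (hS : SuperMultiplicative S)
    {U₁ U₂ : Submodule (R ⧸ m) (O ⧸ m.map (algebraMap R O))} (h1 : 1 ∈ U₁) :
    Module.finrank (R ⧸ m) (U₁ * U₂ : Submodule _ _) <
      Module.finrank (R ⧸ m) U₁ + Module.finrank (R ⧸ m) U₂ := by
  have := hfin _ hm
  have hidx := index_preimageSubspace_mul_pow (O := O) m
  set M := m.map (algebraMap R O) with hM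
  obtain ⟨y, hy⟩ := IsDedekindDomain.exists_sup_span_eq (I := M ^ 2) (J := M)
    (Ideal.pow_le_self two_ne_zero) (pow_ne_zero 2 hm)
  have hyM : y ∈ M := hy ▸ Ideal.mem_sup_right (Ideal.mem_span_singleton_self y)
  have hM2M : ∀ {x}, x ∈ M ^ 2 → x ∈ M := fun hx => Ideal.pow_le_self two_ne_zero hx
  have hMr : ∀ x ∈ M, x ∈ f.range := fun x hx => (hrange x).2 ⟨0, x, hx, by simp⟩
  -- `X U` is `y W + M ^ 2`, where `W` is the preimage of `U`; `J U` is the same as an ideal of `S`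
  let X : Submodule (R ⧸ m) (O ⧸ M) → AddSubgroup O := fun U =>
    (preimageSubspace m U).map (AddMonoidHom.mulLeft y) ⊔ (M ^ 2).toAddSubgroup
  have hmemX : ∀ U x, x ∈ X U ↔ ∃ w, Ideal.Quotient.mk M w ∈ U ∧ ∃ e ∈ M ^ 2, y * w + e = x := by
    intro U x
    simp only [X, AddSubgroup.mem_sup, AddSubgroup.mem_map]
    constructor
    · rintro ⟨_, ⟨w, hw, rfl⟩, e, he, rfl⟩
      exact ⟨w, hw, e, he, rfl⟩
    · rintro ⟨w, hw, e, he, rfl⟩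
      exact ⟨_, ⟨w, hw, rfl⟩, e, he, rfl⟩
  have hXM : ∀ U, X U ≤ M.toAddSubgroup := by
    intro U x hx
    obtain ⟨w, -, e, he, rfl⟩ := (hmemX U x).1 hx
    exact M.add_mem (M.mul_mem_right _ hyM) (hM2M he)
  have hXsmul : ∀ U s x, f x ∈ X U → f (s * x) ∈ X U := by
    intro U s x hx
    obtain ⟨w, hw, e, he, hwe⟩ := (hmemX U _).1 hx
    obtain ⟨r, a, ha, hra⟩ := (hrange (f s)).1 ⟨s, rfl⟩
    refine (hmemX U _).2 ⟨algebraMap R O r * w, ?_, y * a * w + f s * e, ?_, ?_⟩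
    · have : Ideal.Quotient.mk M (algebraMap R O r * w) =
          Ideal.Quotient.mk m r • Ideal.Quotient.mk M w := by
        rw [Algebra.smul_def, map_mul]; rfl
      rw [this]
      exact U.smul_mem _ hw
    · refine add_mem (Ideal.mul_mem_right _ _ ?_) (Ideal.mul_mem_left _ _ he)
      rw [sq]; exact Ideal.mul_mem_mul hyM ha
    · rw [map_mul, ← hwe, hra]; ring
  let J : Submodule (R ⧸ m) (O ⧸ M) → Ideal S := fun U =>
    { carrier := {s | f s ∈ X U}
      zero_mem' := by simp [zero_mem]
      add_mem' := fun {a b} ha hb => by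
        simp only [Set.mem_ofPred_eq, map_add] at *; exact add_mem ha hb
      smul_mem' := fun s x hx => hXsmul U s x hx }
  set t := M.toAddSubgroup.relIndex f.range.toAddSubgroup with ht
  have htpos : t ≠ 0 := relIndex_ne_zero_of_finite le_rfl _
  have ht1 : 1 < t := by
    have : t ≠ 1 := by
      intro h
      have h3 := AddSubgroup.relIndex_eq_one.1 h
      exact hm1 ((Ideal.eq_top_iff_one M).2 (h3 (show (1 : O) ∈ f.range from one_mem _)))
    omega
  have hcard : ∀ Y : AddSubgroup O, Y ≤ M.toAddSubgroup → (Y.comap f.toAddMonoidHom).index =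
      Y.relIndex M.toAddSubgroup * t := by
    intro Y hY
    have h3 : M.toAddSubgroup ≤ f.range.toAddSubgroup := hMr
    rw [AddSubgroup.index_comap, AddSubgroup.relIndex_mul_relIndex _ _ _ hY h3]
    rfl
  have hM2fin := hfin _ (pow_ne_zero 2 hm : M ^ 2 ≠ ⊥)
  have hM3fin := hfin _ (pow_ne_zero 3 hm : M ^ 3 ≠ ⊥)
  have hMpre : ∀ U : Submodule (R ⧸ m) (O ⧸ M), M.toAddSubgroup ≤ preimageSubspace m U := by
    intro U x hx
    have : Ideal.Quotient.mk M x = 0 := Ideal.Quotient.eq_zero_iff_mem.2 hx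
    rw [mem_preimageSubspace, this]
    exact zero_mem _
  -- `[M : y W + M ^ 2] ≥ [O : W]`, as multiplication by `y` is injective on `O / M`
  have hlow : ∀ U : Submodule (R ⧸ m) (O ⧸ M),
      (preimageSubspace m U).index * t ≤ Submodule.cardQuot (J U) := by
    intro U
    have e : Submodule.cardQuot (J U) = ((X U).comap f.toAddMonoidHom).index := rfl
    rw [e, hcard _ (hXM U)]
    refine Nat.mul_le_mul_right _ ?_
    have h4 : (M ^ 2).toAddSubgroup ≤ X U := le_sup_right
    have h5 : (X U).relIndex M.toAddSubgroup ≠ 0 := relIndex_ne_zero_of_finite h4 _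
    have h6 : (⊤ : AddSubgroup O).map (AddMonoidHom.mulLeft y) ≤ M.toAddSubgroup := by
      rintro _ ⟨x, -, rfl⟩
      exact M.mul_mem_right _ hyM
    refine le_trans ?_ (AddSubgroup.relIndex_le_of_le_right h6 h5)
    rw [← AddSubgroup.relIndex_comap, ← AddSubgroup.relIndex_top_right]
    refine AddSubgroup.relIndex_le_of_le_left ?_ ?_
    · intro x hx
      obtain ⟨w, hw, e, he, hwe⟩ := (hmemX U _).1 hx
      have hwe' : y * w + e = y * x := hwe
      have h7 : x - w ∈ M := mem_of_mul_mem_sq hm hy.symm (by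
        have : y * (x - w) = e := by linear_combination -hwe'
        rwa [this])
      have h8 := add_mem (hMpre U h7) (show w ∈ preimageSubspace m U from hw)
      rwa [sub_add_cancel] at h8
    · refine relIndex_ne_zero_of_finite (J := M) ?_ _
      intro x hx
      refine (hmemX U _).2 ⟨0, by simp, y * x, ?_, by simp⟩
      rw [sq]; exact Ideal.mul_mem_mul hyM hx
  let W := preimageSubspace m (U₁ * U₂)
  let Y : AddSubgroup O := W.map (AddMonoidHom.mulLeft (y ^ 2)) ⊔ (M ^ 3).toAddSubgroup
  have hM3 : M ^ 3 = M ^ 2 * M ^ 2 ⊔ Ideal.span {y} * M ^ 2 := by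
    rw [← Ideal.sup_mul, hy]; ring
  have hM32 : M ^ 3 ≤ M ^ 2 := Ideal.pow_le_pow_right (by norm_num)
  have hYM2 : Y ≤ (M ^ 2).toAddSubgroup := by
    refine sup_le ?_ hM32
    rintro _ ⟨w, -, rfl⟩
    exact Ideal.mul_mem_right _ _ (Ideal.pow_mem_pow hyM 2)
  let Z : AddSubgroup O := (J U₁ * J U₂).toAddSubgroup.map f.toAddMonoidHom
  have hZ : ∀ a ∈ X U₁, ∀ b ∈ X U₂, a * b ∈ Z := by
    intro a ha b hb
    obtain ⟨a, rfl⟩ := hMr _ (hXM _ ha)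
    obtain ⟨b, rfl⟩ := hMr _ (hXM _ hb)
    exact ⟨a * b, Ideal.mul_mem_mul ha hb, map_mul f a b⟩
  have hyX : ∀ U w, Ideal.Quotient.mk M w ∈ U → y * w ∈ X U := fun U w hw =>
    (hmemX U _).2 ⟨w, hw, 0, zero_mem _, add_zero _⟩
  have hM2X : ∀ U e, e ∈ M ^ 2 → e ∈ X U := fun U e he =>
    (hmemX U _).2 ⟨0, by simp, e, he, by simp⟩
  -- `M ^ 3 = y M ^ 2 + M ^ 4`, where `y ∈ X U₁` because `1 ∈ U₁`
  have hM3Z : ∀ x ∈ M ^ 3, x ∈ Z := by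
    intro x hx
    rw [hM3] at hx
    obtain ⟨a, ha, b, hb, rfl⟩ := Submodule.mem_sup.1 hx
    refine add_mem ?_ ?_
    · refine Submodule.mul_induction_on ha (fun p hp q hq => hZ _ (hM2X _ _ hp) _ (hM2X _ _ hq))
        (fun p q hp hq => add_mem hp hq)
    · obtain ⟨e, he, rfl⟩ := Ideal.mem_span_singleton_mul.1 hb
      have := hyX U₁ 1 (by simpa using h1)
      rw [mul_one] at this
      exact hZ _ this _ (hM2X _ _ he)
  have hYZ : Y ≤ Z := by
    refine sup_le ?_ hM3Z
    rintro _ ⟨w, hw, rfl⟩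
    change y ^ 2 * w ∈ Z
    obtain ⟨w', hw', hZw'⟩ : ∃ w', Ideal.Quotient.mk M w' = Ideal.Quotient.mk M w ∧
        y ^ 2 * w' ∈ Z := by
      refine Submodule.mul_induction_on (C := fun v => ∃ w', Ideal.Quotient.mk M w' = v ∧
        y ^ 2 * w' ∈ Z) (mem_preimageSubspace.1 hw) ?_ ?_
      · intro a ha b hb
        obtain ⟨a, rfl⟩ := Ideal.Quotient.mk_surjective a
        obtain ⟨b, rfl⟩ := Ideal.Quotient.mk_surjective b
        refine ⟨a * b, map_mul _ _ _, ?_⟩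
        have := hZ _ (hyX _ a ha) _ (hyX _ b hb)
        convert this using 1; ring
      · rintro a b ⟨p, rfl, hp⟩ ⟨q, rfl, hq⟩
        exact ⟨p + q, map_add _ _ _, by rw [mul_add]; exact add_mem hp hq⟩
    have h9 : w - w' ∈ M := by rw [← Ideal.Quotient.eq, hw']
    have h10 : y ^ 2 * (w - w') ∈ M ^ 3 := by
      rw [pow_succ]; exact Ideal.mul_mem_mul (Ideal.pow_mem_pow hyM 2) h9
    have := add_mem hZw' (hM3Z _ h10)
    convert this using 1; ring
  have hYJ : Y.comap f.toAddMonoidHom ≤ (J U₁ * J U₂).toAddSubgroup := by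
    intro s hs
    obtain ⟨s', hs', h⟩ := hYZ hs
    rwa [← hf h]
  have hY0 : (Y.comap f.toAddMonoidHom).index ≠ 0 := by
    have h4 : (M ^ 3).toAddSubgroup ≤ Y := le_sup_right
    rw [hcard _ (hYM2.trans fun x hx => hM2M hx)]
    exact mul_ne_zero (relIndex_ne_zero_of_finite h4 _) htpos
  have hfinIJ : Finite (S ⧸ J U₁ * J U₂) := by
    have : (J U₁ * J U₂).toAddSubgroup.index ≠ 0 := fun h =>
      hY0 (by
        rw [← AddSubgroup.relIndex_top_right] at h ⊢
        exact AddSubgroup.relIndex_eq_zero_of_le_left hYJ h)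
    exact AddSubgroup.index_ne_zero_iff_finite.1 this
  -- `[S : J U₁ J U₂] ≤ [S : M] [M : M ^ 2] [M ^ 2 : y ^ 2 W + M ^ 3]`, and the last two factors are
  -- at most `[O : M]` and `[O : W]`
  have hup : Submodule.cardQuot (J U₁ * J U₂) ≤ W.index * M.toAddSubgroup.index * t := by
    have e : Submodule.cardQuot (J U₁ * J U₂) = (J U₁ * J U₂).toAddSubgroup.index := rfl
    have h4 : (J U₁ * J U₂).toAddSubgroup.index ≤ (Y.comap f.toAddMonoidHom).index :=
      have : (Y.comap f.toAddMonoidHom).FiniteIndex := ⟨hY0⟩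
      AddSubgroup.index_antitone hYJ
    rw [e]
    refine h4.trans ?_
    rw [hcard _ (hYM2.trans fun x hx => hM2M hx)]
    refine Nat.mul_le_mul_right _ ?_
    rw [← AddSubgroup.relIndex_mul_relIndex Y (M ^ 2).toAddSubgroup M.toAddSubgroup hYM2
      (fun x hx => hM2M hx)]
    refine Nat.mul_le_mul ?_ ?_
    · rw [← AddSubgroup.relIndex_top_right]
      refine relIndex_le_of_le_map_sup (AddMonoidHom.mulLeft (y ^ 2)) ?_ ?_
        (relIndex_ne_zero_of_finite (hMpre _) _)
      · exact fun x hx => AddSubgroup.mem_sup_left ⟨x, hx, rfl⟩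
      · intro x hx
        have hx' : x ∈ M ^ 2 := hx
        have hsq : M ^ 2 = M ^ 3 ⊔ Ideal.span {y ^ 2} := by
          refine le_antisymm ?_ (sup_le hM32
            ((Ideal.span_singleton_le_iff_mem _).2 (Ideal.pow_mem_pow hyM 2)))
          have e5 : M ^ 2 = M * (M ^ 2 ⊔ Ideal.span {y}) := by rw [hy, sq]
          have e6 : M * Ideal.span {y} ≤ M ^ 3 ⊔ Ideal.span {y ^ 2} := by
            conv_lhs => rw [← hy, Ideal.sup_mul, Ideal.span_singleton_mul_span_singleton, ← sq]
            refine sup_le_sup_right ?_ _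
            rw [pow_succ M 2]
            exact Ideal.mul_mono_right ((Ideal.span_singleton_le_iff_mem _).2 hyM)
          conv_lhs => rw [e5, Ideal.mul_sup]
          refine sup_le (le_sup_of_le_left ?_) e6
          rw [← pow_succ']
        rw [hsq] at hx'
        obtain ⟨a, ha, b, hb, rfl⟩ := Submodule.mem_sup.1 hx'
        obtain ⟨e, rfl⟩ := Ideal.mem_span_singleton'.1 hb
        rw [add_comm, mul_comm e]
        exact AddSubgroup.add_mem_sup ⟨e, trivial, rfl⟩
          (AddSubgroup.mem_sup_right (T := (M ^ 3).toAddSubgroup) ha)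
    · rw [← AddSubgroup.relIndex_top_right]
      refine relIndex_le_of_le_map_sup (AddMonoidHom.mulLeft y) ?_ ?_
        (relIndex_ne_zero_of_finite le_rfl _)
      · intro x hx
        change y * x ∈ M ^ 2
        rw [sq]; exact Ideal.mul_mem_mul hyM hx
      · intro x hx
        have hx' : x ∈ M := hx
        rw [← hy] at hx'
        obtain ⟨a, ha, b, hb, rfl⟩ := Submodule.mem_sup.1 hx'
        obtain ⟨e, rfl⟩ := Ideal.mem_span_singleton'.1 hb
        rw [add_comm, mul_comm e]
        exact AddSubgroup.add_mem_sup ⟨e, trivial, rfl⟩ ha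
  have main := (Nat.mul_le_mul (hlow U₁) (hlow U₂)).trans ((hS _ _ hfinIJ).trans hup)
  -- `[O : Wᵢ] = q ^ (d - dim Uᵢ)` with `q = #(R ⧸ m)` and `q ^ d = #(O ⧸ M)`, so that, after
  -- dividing by `t = [S : M]`, a failure of the claim would force `t ≤ 1`
  set q := Nat.card (R ⧸ m) with hq
  have hq1 : 1 < q := by
    have : Nontrivial (R ⧸ m) := Ideal.Quotient.nontrivial_iff.2 (Ideal.IsMaximal.ne_top ‹_›)
    exact Finite.one_lt_card
  have hD : M.toAddSubgroup.index = Nat.card (O ⧸ M) := rfl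
  have hD0 : 0 < Nat.card (O ⧸ M) := Nat.card_pos
  have i1 := hidx U₁
  have i2 := hidx U₂
  have i3 := hidx (U₁ * U₂)
  rw [hD] at main
  by_contra! hcon
  set D := Nat.card (O ⧸ M)
  set u₁ := Module.finrank (R ⧸ m) U₁
  set u₂ := Module.finrank (R ⧸ m) U₂
  set u := Module.finrank (R ⧸ m) (U₁ * U₂ : Submodule _ _)
  set w₁ := (preimageSubspace m U₁).index
  set w₂ := (preimageSubspace m U₂).index
  have hpow : q ^ (u₁ + u₂) ≤ q ^ u := Nat.pow_le_pow_right hq1.le hcon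
  have htpos' : 0 < t := by omega
  have j1 : w₁ * w₂ * t ≤ W.index * D := by
    refine Nat.le_of_mul_le_mul_right ?_ htpos'
    calc w₁ * w₂ * t * t = w₁ * t * (w₂ * t) := by ring
      _ ≤ _ := main
  have j2 : D * D * t ≤ D * D := by
    calc D * D * t = (w₁ * q ^ u₁) * (w₂ * q ^ u₂) * t := by rw [i1, i2]
      _ = w₁ * w₂ * t * q ^ (u₁ + u₂) := by ring
      _ ≤ (W.index * D) * q ^ u := Nat.mul_le_mul j1 hpow
      _ = W.index * q ^ u * D := by ring
      _ = D * D := by rw [i3]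
  have : t ≤ 1 := by
    refine Nat.le_of_mul_le_mul_left ?_ (Nat.mul_pos hD0 hD0)
    simpa using j2
  omega

theorem isPrincipal_quotient {M : Ideal O} (hM : M ≠ ⊥) (N : Ideal (O ⧸ M)) : N.IsPrincipal := by
  obtain ⟨a, ha⟩ := IsDedekindDomain.exists_sup_span_eq (I := M)
    (J := N.comap (Ideal.Quotient.mk M))
    (by conv_lhs => rw [← Ideal.mk_ker (I := M)]
        exact Ideal.comap_mono bot_le) hM
  refine ⟨Ideal.Quotient.mk M a, ?_⟩
  rw [← Ideal.map_comap_of_surjective _ Ideal.Quotient.mk_surjective N, ← ha, Ideal.map_sup,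
    Ideal.map_quotient_self, bot_sup_eq, Ideal.map_span, Set.image_singleton]

/-- If `1, x, z, x z` are linearly independent in `O / m O`, then `U₁ = ⟨1, x⟩` and `U₂ = ⟨1, z⟩`
have a product of dimension at least `4 = dim U₁ + dim U₂`, so `R + m O` is not
super-multiplicative. -/
theorem finrank_quotient_map_le_three
    (hfin : ∀ J : Ideal O, J ≠ ⊥ → Finite (O ⧸ J))
    (m : Ideal R) [hmax : m.IsMaximal] [Finite (R ⧸ m)]
    (hm : m.map (algebraMap R O) ≠ ⊥)
    (f : S →+* O) (hf : Function.Injective f)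
    (hrange : ∀ x : O, x ∈ f.range ↔
      ∃ r : R, ∃ a ∈ m.map (algebraMap R O), x = algebraMap R O r + a)
    (hS : SuperMultiplicative S) :
    Module.finrank (R ⧸ m) (O ⧸ m.map (algebraMap R O)) ≤ 3 := by
  have := hfin _ hm
  by_contra! hd
  let := Ideal.Quotient.field m
  have : Module.Finite (R ⧸ m) (O ⧸ m.map (algebraMap R O)) := Module.Finite.of_finite
  have : Nontrivial (O ⧸ m.map (algebraMap R O)) :=
    Module.nontrivial_of_finrank_pos (R := R ⧸ m) (by omega)
  have hm1 : m.map (algebraMap R O) ≠ ⊤ := Ideal.Quotient.nontrivial_iff.1 this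
  obtain ⟨x, z, hxz⟩ := exists_linearIndependent_quadruple (k := R ⧸ m) hd
    (isPrincipal_quotient hm _)
  have key := finrank_mul_lt_of_superMultiplicative hfin m hm hm1 f hf hrange hS
    (U₁ := Submodule.span (R ⧸ m) {x, 1}) (U₂ := Submodule.span (R ⧸ m) {z, 1})
    (Submodule.subset_span (by simp))
  classical
  have hpair : ∀ v : O ⧸ m.map (algebraMap R O),
      Module.finrank (R ⧸ m) (Submodule.span (R ⧸ m) {v, 1}) ≤ 2 := by
    intro v
    have h2 := finrank_span_finset_le_card (R := R ⧸ m)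
      ({v, 1} : Finset (O ⧸ m.map (algebraMap R O)))
    rw [Set.finrank, Finset.coe_pair] at h2
    exact h2.trans Finset.card_le_two
  have hquad : 4 ≤ Module.finrank (R ⧸ m)
      (Submodule.span (R ⧸ m) {x, 1} * Submodule.span (R ⧸ m) {z, 1} : Submodule _ _) := by
    have h4 := finrank_span_eq_card hxz
    refine (Fintype.card_fin 4 ▸ h4).symm.le.trans (Submodule.finrank_mono ?_)
    rw [Submodule.span_le, Submodule.span_mul_span]
    rintro _ ⟨i, rfl⟩
    apply Submodule.subset_span
    fin_cases i
    · exact Set.mul_mem_mul (by simp) (by simp)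
    · exact ⟨1, by simp, z, by simp, by simp⟩
    · exact ⟨x, by simp, 1, by simp, by simp⟩
    · exact ⟨1, by simp, 1, by simp, by simp⟩
  have := hpair x
  have := hpair z
  omega

end SuperMultiplicative

/-! ### From local to global generators -/

section Generators

variable {R : Type*} [CommRing R]

/-- The Chinese remainder theorem for elements of an ideal `I` and the quotients `I / m I`. -/
theorem exists_mem_forall_sub_mem_mul (T : Finset (Ideal R)) (hT : ∀ m ∈ T, m.IsMaximal)
    (I : Ideal R) (g : Ideal R → R) (hg : ∀ m ∈ T, g m ∈ I) :
    ∃ a ∈ I, ∀ m ∈ T, a - g m ∈ m * I := by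
  classical
  have hco : Pairwise (Function.onFun IsCoprime (fun m : T => (m : Ideal R))) := by
    intro m n hmn
    exact Ideal.isCoprime_iff_sup_eq.2
      ((hT m m.2).coprime_of_ne (hT n n.2) (fun h => hmn (Subtype.ext h)))
  have hex : ∀ n : T, ∃ r : R, ∀ m : T, r - (if m = n then 1 else 0) ∈ (m : Ideal R) :=
    fun n => Ideal.exists_forall_sub_mem_ideal hco (fun m => if m = n then 1 else 0)
  choose e he using hex
  refine ⟨∑ n : T, e n * g n, sum_mem fun n _ => I.mul_mem_left _ (hg n n.2), fun m hm => ?_⟩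
  have h1 : ∑ n : T, e n * g n - g m =
      ∑ n : T, (e n - (if (⟨m, hm⟩ : T) = n then 1 else 0)) * g n := by
    simp [sub_mul, Finset.sum_sub_distrib]
  rw [h1]
  exact sum_mem fun n _ => Ideal.mul_mem_mul (he n ⟨m, hm⟩) (hg n n.2)

/-- Nakayama's lemma at all maximal ideals simultaneously. -/
theorem le_of_forall_isMaximal_le_sup_mul {I J : Ideal R} (hI : I.FG)
    (h : ∀ m : Ideal R, m.IsMaximal → I ≤ J ⊔ m * I) : I ≤ J := by
  by_contra hIJ
  have hne : J.colon (I : Set R) ≠ ⊤ := by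
    intro htop
    apply hIJ
    intro x hx
    have h1 : (1 : R) ∈ J.colon (I : Set R) := htop ▸ Submodule.mem_top
    simpa using (Submodule.mem_colon.1 h1) x hx
  obtain ⟨m, hm, hle⟩ := Ideal.exists_le_maximal _ hne
  let Q := Submodule.map J.mkQ I
  have hQ : Q ≤ m • Q := by
    rintro _ ⟨x, hx, rfl⟩
    obtain ⟨a, ha, b, hb, rfl⟩ := Submodule.mem_sup.1 (h m hm hx)
    have h2 : J.mkQ a = 0 := (Submodule.Quotient.mk_eq_zero J).2 ha
    rw [map_add, h2, zero_add, ← Submodule.map_smul'']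
    exact ⟨b, hb, rfl⟩
  obtain ⟨r, hr1, hr⟩ := Submodule.exists_sub_one_mem_and_smul_eq_zero_of_fg_of_le_smul m Q
    (Submodule.FG.map J.mkQ hI) hQ
  have hrm : r ∈ m := by
    apply hle
    refine Submodule.mem_colon.2 fun x hx => ?_
    have := hr (J.mkQ x) ⟨x, hx, rfl⟩
    rw [← map_smul] at this
    exact (Submodule.Quotient.mk_eq_zero J).1 this
  exact hm.ne_top ((Ideal.eq_top_iff_one m).2 (by simpa using sub_mem hrm hr1))

theorem le_span_sup_mul_of_notMem {I m : Ideal R} [hm : m.IsMaximal] {a : R}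
    (ham : a ∉ m) : I ≤ Ideal.span {a} ⊔ m * I := by
  obtain ⟨b, c, hc, hbc⟩ := hm.exists_inv ham
  intro x hx
  have h1 : x = (x * b) * a + c * x := by linear_combination -x * hbc
  rw [h1]
  exact Submodule.add_mem_sup (Ideal.mem_span_singleton'.2 ⟨_, rfl⟩) (Ideal.mul_mem_mul hc hx)

/-- If `I / m I` has dimension at most three, any prescribed element outside `m I` is one of three
generators of `I` modulo `m I`. The dimension is expressed through the index `[I : m I]`. -/
theorem exists_le_span_triple_sup_mul {I m : Ideal R} [hm : m.IsMaximal] [Finite (R ⧸ m)]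
    (h0 : (m * I).toAddSubgroup.relIndex I.toAddSubgroup ≠ 0)
    (h3 : (m * I).toAddSubgroup.relIndex I.toAddSubgroup ≤ Nat.card (R ⧸ m) ^ 3)
    {a : R} (haI : a ∈ I) (ha : a ∉ m * I) :
    ∃ b ∈ I, ∃ c ∈ I, I ≤ Ideal.span {a, b, c} ⊔ m * I := by
  set q := Nat.card (R ⧸ m) with hq
  have hq0 : 0 < q := Nat.card_pos
  -- adjoining one element outside `J` multiplies the index by at least `q`
  have step : ∀ (J : Ideal R), m * I ≤ J → J ≤ I → ∀ x ∈ I, x ∉ J →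
      q * (J ⊔ Ideal.span {x}).toAddSubgroup.relIndex I.toAddSubgroup ≤
        J.toAddSubgroup.relIndex I.toAddSubgroup := by
    intro J hmJ hJI x hx hxJ
    have hle : J ⊔ Ideal.span {x} ≤ I := sup_le hJI ((Ideal.span_singleton_le_iff_mem _).2 hx)
    rw [← AddSubgroup.relIndex_mul_relIndex J.toAddSubgroup (J ⊔ Ideal.span {x}).toAddSubgroup
      I.toAddSubgroup (fun y hy => Ideal.mem_sup_left hy) hle]
    refine Nat.mul_le_mul_right _ ?_
    have hJ0 : J.toAddSubgroup.relIndex (J ⊔ Ideal.span {x}).toAddSubgroup ≠ 0 := by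
      intro h
      apply h0
      exact AddSubgroup.relIndex_eq_zero_of_le_left
        (show (m * I).toAddSubgroup ≤ J.toAddSubgroup from hmJ)
        (AddSubgroup.relIndex_eq_zero_of_le_right hle h)
    have e : (m.toAddSubgroup).index = q := rfl
    rw [← e, ← AddSubgroup.relIndex_top_right]
    have hcomap : J.toAddSubgroup.comap (AddMonoidHom.mulRight x) ≤ m.toAddSubgroup := by
      intro r hr
      by_contra hrm
      obtain ⟨b, c, hc, hbc⟩ := hm.exists_inv hrm
      apply hxJ
      have h1 : x = b * (r * x) + c * x := by linear_combination -x * hbc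
      rw [h1]
      exact add_mem (J.mul_mem_left _ hr) (hmJ (Ideal.mul_mem_mul hc hx))
    have hmap : (⊤ : AddSubgroup R).map (AddMonoidHom.mulRight x) ≤
        (J ⊔ Ideal.span {x}).toAddSubgroup := by
      rintro _ ⟨r, -, rfl⟩
      exact Ideal.mem_sup_right (Ideal.mem_span_singleton'.2 ⟨r, rfl⟩)
    refine le_trans ?_ (AddSubgroup.relIndex_le_of_le_right hmap hJ0)
    rw [← AddSubgroup.relIndex_comap]
    refine AddSubgroup.relIndex_le_of_le_left hcomap ?_
    rw [AddSubgroup.relIndex_comap]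
    exact fun h => hJ0 (AddSubgroup.relIndex_eq_zero_of_le_right hmap h)
  by_contra! H
  let J₁ := m * I ⊔ Ideal.span {a}
  have hJ₁ : J₁ ≤ I := sup_le Ideal.mul_le_right ((Ideal.span_singleton_le_iff_mem _).2 haI)
  have H' : ∀ b ∈ I, ∀ c ∈ I, ¬ I ≤ J₁ ⊔ Ideal.span {b} ⊔ Ideal.span {c} := by
    intro b hb c hc h
    refine H b hb c hc (h.trans (le_of_eq ?_))
    rw [Ideal.span_insert, Ideal.span_insert]
    simp only [J₁]
    ac_rfl
  obtain ⟨b, hb, hbJ⟩ := SetLike.not_le_iff_exists.1 (show ¬ I ≤ J₁ by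
    simpa using H' 0 (zero_mem _) 0 (zero_mem _))
  have hJ₂ : J₁ ⊔ Ideal.span {b} ≤ I := sup_le hJ₁ ((Ideal.span_singleton_le_iff_mem _).2 hb)
  obtain ⟨c, hc, hcJ⟩ := SetLike.not_le_iff_exists.1 (show ¬ I ≤ J₁ ⊔ Ideal.span {b} by
    simpa using H' b hb 0 (zero_mem _))
  have hJ₃ : J₁ ⊔ Ideal.span {b} ⊔ Ideal.span {c} ≤ I :=
    sup_le hJ₂ ((Ideal.span_singleton_le_iff_mem _).2 hc)
  obtain ⟨d, hd, hdJ⟩ := SetLike.not_le_iff_exists.1 (H' b hb c hc)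
  have s0 := step (m * I) le_rfl Ideal.mul_le_right a haI ha
  have s1 := step J₁ le_sup_left hJ₁ b hb hbJ
  have s2 := step _ (le_sup_left.trans le_sup_left) hJ₂ c hc hcJ
  have s3 := step _ ((le_sup_left.trans le_sup_left).trans le_sup_left) hJ₃ d hd hdJ
  have hle : m * I ≤ J₁ ⊔ Ideal.span {b} ⊔ Ideal.span {c} ⊔ Ideal.span {d} :=
    le_sup_of_le_left (le_sup_of_le_left (le_sup_of_le_left le_sup_left))
  have s4 : (J₁ ⊔ Ideal.span {b} ⊔ Ideal.span {c} ⊔ Ideal.span {d}).toAddSubgroup.relIndex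
      I.toAddSubgroup ≠ 0 := fun h =>
    h0 (AddSubgroup.relIndex_eq_zero_of_le_left
      (show (m * I).toAddSubgroup ≤ _ from hle) h)
  have hq1 : 1 < q := by
    have : Nontrivial (R ⧸ m) := Ideal.Quotient.nontrivial_iff.2 hm.ne_top
    exact Finite.one_lt_card
  have : q ^ 4 ≤ q ^ 3 := by
    refine le_trans ?_ h3
    refine le_trans ?_ s0
    rw [pow_succ']
    refine Nat.mul_le_mul_left _ (le_trans ?_ s1)
    rw [pow_succ']
    refine Nat.mul_le_mul_left _ (le_trans ?_ s2)
    rw [pow_succ']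
    refine Nat.mul_le_mul_left _ (le_trans ?_ s3)
    rw [pow_one]
    exact Nat.le_mul_of_pos_right _ (Nat.pos_of_ne_zero s4)
  exact absurd ((Nat.pow_le_pow_iff_right hq1).1 this) (by norm_num)

/-- The local bound on the number of generators holds globally. A nonzero `a ∈ I` is chosen outside
`m I` for the finitely many `m` at which `I / m I` can have dimension greater than one; at every `m`
containing `a`, two more elements then generate `I` modulo `m I + a R`, and those can be chosen
simultaneously because only finitely many `m` contain `a`. At the other `m`, the element `a`
suffices. -/
theorem exists_eq_span_triple [IsNoetherianRing R] [IsDomain R]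
    (hfin : ∀ J : Ideal R, J ≠ ⊥ → Finite (R ⧸ J)) {I : Ideal R} (hI : I ≠ ⊥)
    (h : ∀ m : Ideal R, m.IsMaximal → m ≠ ⊥ →
      (m * I).toAddSubgroup.relIndex I.toAddSubgroup ≠ 0 ∧
      (m * I).toAddSubgroup.relIndex I.toAddSubgroup ≤ Nat.card (R ⧸ m) ^ 3) :
    ∃ a b c : R, I = Ideal.span {a, b, c} := by
  classical
  have hT : ∀ x : R, x ≠ 0 → ∃ T : Finset (Ideal R), ∀ m, m ∈ T ↔ m.IsMaximal ∧ x ∈ m := by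
    intro x hx
    have := hfin (Ideal.span {x}) (by simpa using hx)
    have hs : {m : Ideal R | m.IsMaximal ∧ x ∈ m}.Finite := by
      refine Set.Finite.of_finite_image (f := Ideal.map (Ideal.Quotient.mk (Ideal.span {x})))
        (Set.toFinite _) ?_
      intro m hm n hn hmn
      have key : ∀ k : Ideal R, x ∈ k → (k.map (Ideal.Quotient.mk (Ideal.span {x}))).comap
          (Ideal.Quotient.mk (Ideal.span {x})) = k := by
        intro k hk
        rw [Ideal.comap_map_of_surjective _ Ideal.Quotient.mk_surjective,
          ← RingHom.ker_eq_comap_bot, Ideal.mk_ker, sup_eq_left, Ideal.span_singleton_le_iff_mem]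
        exact hk
      rw [← key m hm.2, ← key n hn.2, hmn]
    exact ⟨hs.toFinset, fun m => by simp⟩
  have hIfg : I.FG := IsNoetherian.noetherian I
  have hne : ∀ m : Ideal R, m.IsMaximal → ¬ I ≤ m * I := by
    intro m hm hle
    obtain ⟨r, hr1, hr⟩ :=
      Submodule.exists_sub_one_mem_and_smul_eq_zero_of_fg_of_le_smul m I hIfg hle
    obtain ⟨x, hx, hx0⟩ := Submodule.exists_mem_ne_zero_of_ne_bot hI
    have hr0 : r = 0 := (mul_eq_zero.1 (hr x hx)).resolve_right hx0
    rw [hr0, zero_sub, neg_mem_iff] at hr1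
    exact hm.ne_top ((Ideal.eq_top_iff_one m).2 hr1)
  obtain ⟨x, hx, hx0⟩ := Submodule.exists_mem_ne_zero_of_ne_bot hI
  obtain ⟨T, hTx⟩ := hT x hx0
  -- `T` contains all `m` at which `I / m I` has dimension greater than one
  obtain ⟨a, haI, ha0, ha⟩ : ∃ a ∈ I, a ≠ 0 ∧ ∀ m ∈ T, a ∉ m * I := by
    rcases T.eq_empty_or_nonempty with rfl | ⟨m₀, hm₀⟩
    · exact ⟨x, hx, hx0, by simp⟩
    · have hg : ∀ m : Ideal R, ∃ g ∈ I, m ∈ T → g ∉ m * I := by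
        intro m
        by_cases hm : m ∈ T
        · obtain ⟨g, hg, hg'⟩ := SetLike.not_le_iff_exists.1 (hne m ((hTx m).1 hm).1)
          exact ⟨g, hg, fun _ => hg'⟩
        · exact ⟨0, zero_mem _, fun h => absurd h hm⟩
      choose g hgI hg using hg
      obtain ⟨a, haI, ha⟩ := exists_mem_forall_sub_mem_mul T (fun m hm => ((hTx m).1 hm).1) I g
        (fun m _ => hgI m)
      have ha' : ∀ m ∈ T, a ∉ m * I := fun m hm h => hg m hm (by
        simpa using sub_mem h (ha m hm))
      refine ⟨a, haI, ?_, ha'⟩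
      rintro rfl
      exact ha' m₀ hm₀ (zero_mem _)
  obtain ⟨T', hTa⟩ := hT a ha0
  have hbc : ∀ m : Ideal R, ∃ b ∈ I, ∃ c ∈ I, m ∈ T' → I ≤ Ideal.span {a, b, c} ⊔ m * I := by
    intro m
    by_cases hm : m ∈ T'
    · obtain ⟨hmax, ham⟩ := (hTa m).1 hm
      by_cases hxm : x ∈ m
      · have hm0 : m ≠ ⊥ := fun h => hx0 (by rwa [h, Ideal.mem_bot] at hxm)
        have := hfin m hm0
        obtain ⟨b, hb, c, hc, hle⟩ := exists_le_span_triple_sup_mul (h m hmax hm0).1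
          (h m hmax hm0).2 haI (ha m ((hTx m).2 ⟨hmax, hxm⟩))
        exact ⟨b, hb, c, hc, fun _ => hle⟩
      · refine ⟨x, hx, 0, zero_mem _, fun _ => (le_span_sup_mul_of_notMem hxm).trans ?_⟩
        exact sup_le_sup_right (Ideal.span_mono (by simp)) _
    · exact ⟨0, zero_mem _, 0, zero_mem _, fun h => absurd h hm⟩
  choose gb hgb gc hgc hg using hbc
  have hT'max : ∀ m ∈ T', m.IsMaximal := fun m hm => ((hTa m).1 hm).1
  obtain ⟨b, hbI, hb⟩ := exists_mem_forall_sub_mem_mul T' hT'max I gb (fun m _ => hgb m)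
  obtain ⟨c, hcI, hc⟩ := exists_mem_forall_sub_mem_mul T' hT'max I gc (fun m _ => hgc m)
  refine ⟨a, b, c, le_antisymm (le_of_forall_isMaximal_le_sup_mul hIfg fun m hm => ?_) ?_⟩
  · by_cases ham : a ∈ m
    · have hmT : m ∈ T' := (hTa m).2 ⟨hm, ham⟩
      refine (hg m hmT).trans (sup_le (Ideal.span_le.2 ?_) le_sup_right)
      have hmem : ∀ u v : R, u ∈ ({a, b, c} : Set R) → u - v ∈ m * I →
          v ∈ Ideal.span {a, b, c} ⊔ m * I := by
        intro u v hu huv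
        have := sub_mem (Ideal.mem_sup_left (T := m * I) (Ideal.subset_span hu))
          (Ideal.mem_sup_right (S := Ideal.span {a, b, c}) huv)
        rwa [sub_sub_cancel] at this
      rintro v (rfl | rfl | rfl)
      · exact Ideal.mem_sup_left (Ideal.subset_span (by simp))
      · exact hmem b _ (by simp) (hb m hmT)
      · exact hmem c _ (by simp) (hc m hmT)
    · exact (le_span_sup_mul_of_notMem ham).trans
        (sup_le_sup_right (Ideal.span_mono (by simp)) _)
  · rw [Ideal.span_le]
    rintro v (rfl | rfl | rfl) <;> assumption

end Generators

/-! ### Finite quotients of subrings of number fields -/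

section FiniteQuotients

/-- A subgroup `G` of a `ℚ`-vector space of dimension `r` satisfies `#(G / n G) ≤ n ^ r`, as any
finite number of its elements lie in a free abelian group of rank at most `r`. -/
theorem finite_quotient_span_natCast {K : Type*} [Field K] [NumberField K] (R : Subring K)
    {n : ℕ} (hn : 0 < n) : Finite (R ⧸ Ideal.span {(n : R)}) := by
  classical
  by_contra hinf
  rw [not_finite_iff_infinite] at hinf
  set Q := R ⧸ Ideal.span {(n : R)} with hQ
  set r := Module.finrank ℚ K with hr
  obtain ⟨t, ht⟩ := Infinite.exists_subset_card_eq Q (n ^ r + 1)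
  have hsurj : Function.Surjective (Ideal.Quotient.mk (Ideal.span {(n : R)})) :=
    Ideal.Quotient.mk_surjective
  -- the lifts of `t` generate a free abelian group of rank at most `r`
  let H : Submodule ℤ R := Submodule.span ℤ (t.image (Function.surjInv hsurj) : Finset R)
  have hHfin : Module.Finite ℤ H := Module.Finite.iff_fg.2 ⟨_, rfl⟩
  let b := Module.finBasis ℤ H
  set s := Module.finrank ℤ H with hs
  have hsr : s ≤ r := by
    have h1 : LinearIndependent ℤ (fun i => ((b i : R) : K)) := by
      have h2 := b.linearIndependent
      have h3 := h2.map' ((R.subtype.toAddMonoidHom.toIntLinearMap).comp H.subtype) (by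
        rw [LinearMap.ker_eq_bot]
        exact Subtype.val_injective.comp Subtype.val_injective)
      exact h3
    rw [LinearIndependent.iff_fractionRing ℤ ℚ] at h1
    simpa using h1.fintype_card_le_finrank
  have hnQ : (n : Q) = 0 := by
    have : ((n : R) : Q) = 0 :=
      Ideal.Quotient.eq_zero_iff_mem.2 (Ideal.mem_span_singleton_self _)
    simpa using this
  let φ : (Fin s → Fin n) → Q := fun c => ∑ i, ((c i : ℕ) : Q) * Ideal.Quotient.mk _ (b i : R)
  have hsub : t ⊆ Finset.univ.image φ := by
    intro v hv
    have hvH : Function.surjInv hsurj v ∈ H :=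
      Submodule.subset_span (by simpa using ⟨v, hv, rfl⟩)
    have h1 := b.sum_repr ⟨_, hvH⟩
    set e := b.repr ⟨_, hvH⟩ with he
    have h2 : ∑ i, (e i : Q) * Ideal.Quotient.mk (Ideal.span {(n : R)}) (b i : R) = v := by
      conv_rhs => rw [← Function.surjInv_eq hsurj v]
      have h3 := congrArg (fun y : H => Ideal.Quotient.mk (Ideal.span {(n : R)}) (y : R)) h1
      simp only [Submodule.coe_sum, map_sum, Submodule.coe_smul, zsmul_eq_mul, map_mul,
        map_intCast] at h3
      exact h3
    have hn0 : (n : ℤ) ≠ 0 := by exact_mod_cast hn.ne'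
    refine Finset.mem_image.2 ⟨fun i => ⟨(e i % n).toNat, ?_⟩, Finset.mem_univ _, ?_⟩
    · have h4 := Int.emod_nonneg (e i) hn0
      have h5 := Int.emod_lt_of_pos (e i) (by exact_mod_cast hn : (0 : ℤ) < n)
      omega
    · refine Eq.trans (Finset.sum_congr rfl fun i _ => ?_) h2
      congr 1
      have h4 : (((e i % n).toNat : ℤ) : Q) = ((e i % n : ℤ) : Q) := by
        rw [Int.toNat_of_nonneg (Int.emod_nonneg (e i) hn0)]
      have h5 := congrArg (Int.cast : ℤ → Q) (Int.emod_add_mul_ediv (e i) n)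
      rw [Int.cast_natCast] at h4
      rw [Int.cast_add, Int.cast_mul, Int.cast_natCast, hnQ, zero_mul, add_zero] at h5
      exact h4.trans h5
  have hcard := (Finset.card_le_card hsub).trans Finset.card_image_le
  rw [ht, Finset.card_univ, Fintype.card_fun, Fintype.card_fin, Fintype.card_fin] at hcard
  have := hcard.trans (Nat.pow_le_pow_right hn hsr)
  omega

theorem finite_quotient_of_ne_bot {K : Type*} [Field K] [NumberField K] (R : Subring K)
    (J : Ideal R) (hJ : J ≠ ⊥) : Finite (R ⧸ J) := by
  obtain ⟨x, hx, hx0⟩ := Submodule.exists_mem_ne_zero_of_ne_bot hJ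
  have halg : IsAlgebraic ℤ x := by
    have h1 : IsAlgebraic ℚ (x : K) := Algebra.IsAlgebraic.isAlgebraic _
    have h2 : IsAlgebraic ℤ (x : K) := (IsFractionRing.isAlgebraic_iff ℤ ℚ K).2 h1
    exact (isAlgebraic_algHom_iff (R.subtype.toIntAlgHom) Subtype.val_injective).1 h2
  obtain ⟨n, hn, hn0⟩ := Submodule.exists_mem_ne_zero_of_ne_bot
    (Ideal.comap_ne_bot_of_algebraic_mem hx0 hx halg)
  have hn' : (n.natAbs : R) ∈ J := by
    have hn1 : ((n : ℤ) : R) ∈ J := by simpa using hn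
    rcases Int.natAbs_eq n with h | h
    · rw [h] at hn1; simpa using hn1
    · rw [h] at hn1; simpa using hn1
  have := finite_quotient_span_natCast R (Int.natAbs_pos.2 hn0)
  exact Finite.of_surjective _ (Ideal.Quotient.factor_surjective
    ((Ideal.span_singleton_le_iff_mem _).2 hn'))

theorem isNoetherianRing_of_finite_quotients {R : Type*} [CommRing R]
    (h : ∀ J : Ideal R, J ≠ ⊥ → Finite (R ⧸ J)) : IsNoetherianRing R := by
  rw [isNoetherianRing_iff_ideal_fg]
  intro I
  rcases eq_or_ne I ⊥ with rfl | hI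
  · exact Submodule.fg_bot
  obtain ⟨x, hx, hx0⟩ := Submodule.exists_mem_ne_zero_of_ne_bot hI
  have := h (Ideal.span {x}) (by simpa using hx0)
  refine Submodule.fg_of_fg_map_of_fg_inf_ker (Submodule.mkQ (Ideal.span {x})) ?_ ?_
  · exact Module.Finite.iff_fg.1 (Module.Finite.of_finite)
  · rw [Submodule.ker_mkQ, inf_eq_right.2 ((Ideal.span_singleton_le_iff_mem _).2 hx)]
    exact Submodule.fg_span_singleton x

theorem dimensionLEOne_of_finite_quotients {R : Type*} [CommRing R]
    (h : ∀ J : Ideal R, J ≠ ⊥ → Finite (R ⧸ J)) : Ring.DimensionLEOne R :=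
  ⟨fun {p} hp0 hp => by
    have := h p hp0
    exact Ideal.Quotient.maximal_of_isField _ (Finite.isField_of_domain _)⟩

end FiniteQuotients

/-! ### Rings above a Dedekind domain and the conductor -/

section Conductor

/-- The fractional ideal generated by `1` and `x` is invertible; `p` and `q` belong to its
inverse. -/
theorem exists_inv_pair {D F : Type*} [CommRing D] [IsDedekindDomain D] [Field F] [Algebra D F]
    [IsFractionRing D F] (x : F) :
    ∃ p q : F, p + q * x = 1 ∧ (∃ d : D, algebraMap D F d = q) ∧
      (∃ d : D, algebraMap D F d = p * x) ∧ (∃ d : D, algebraMap D F d = q * x) := by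
  let J : FractionalIdeal (nonZeroDivisors D) F :=
    FractionalIdeal.spanSingleton _ 1 + FractionalIdeal.spanSingleton _ x
  have h1J : (1 : F) ∈ J := by
    rw [← FractionalIdeal.mem_coe, FractionalIdeal.coe_add]
    exact Submodule.mem_sup_left (FractionalIdeal.mem_spanSingleton_self _ _)
  have hxJ : x ∈ J := by
    rw [← FractionalIdeal.mem_coe, FractionalIdeal.coe_add]
    exact Submodule.mem_sup_right (FractionalIdeal.mem_spanSingleton_self _ _)
  have hJ0 : J ≠ 0 := by
    intro h
    rw [h, FractionalIdeal.mem_zero_iff] at h1J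
    exact one_ne_zero h1J
  have hmul : (1 : F) ∈ J * J⁻¹ := by
    rw [mul_inv_cancel₀ hJ0]; exact FractionalIdeal.one_mem_one _
  rw [add_mul, ← FractionalIdeal.mem_coe, FractionalIdeal.coe_add] at hmul
  obtain ⟨a, ha, b, hb, hab⟩ := Submodule.mem_sup.1 hmul
  obtain ⟨p, hp, rfl⟩ := FractionalIdeal.mem_singleton_mul.1 ha
  obtain ⟨q, hq, rfl⟩ := FractionalIdeal.mem_singleton_mul.1 hb
  rw [FractionalIdeal.mem_inv_iff hJ0] at hp hq
  refine ⟨p, q, by rw [← hab]; ring, ?_, ?_, ?_⟩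
  · simpa using (FractionalIdeal.mem_one_iff _).1 (hq 1 h1J)
  · exact (FractionalIdeal.mem_one_iff _).1 (hp x hxJ)
  · exact (FractionalIdeal.mem_one_iff _).1 (hq x hxJ)

/-- Every ring between a Dedekind domain and its fraction field is integrally closed. -/
theorem mem_of_isIntegral_of_dedekind_le {D R F : Type*} [CommRing D] [IsDedekindDomain D]
    [Field F] [Algebra D F] [IsFractionRing D F] [CommRing R] [Algebra R F] (T : Subalgebra R F)
    (hT : ∀ d : D, algebraMap D F d ∈ T) {x : F} (hx : IsIntegral T x) : x ∈ T := by
  obtain ⟨p, q, hpq, ⟨d, hd⟩, ⟨d', hd'⟩, ⟨d'', hd''⟩⟩ := exists_inv_pair (D := D) x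
  have hqT : q ∈ T := hd ▸ hT d
  have hpxT : p * x ∈ T := hd' ▸ hT d'
  have hqxT : q * x ∈ T := hd'' ▸ hT d''
  -- multiplying an integral equation by `q` and using `q x = 1 - p` lowers its degree
  have descent : ∀ n : ℕ, ∀ t : ℕ → F, (∀ i, t i ∈ T) →
      x ^ (n + 1) = ∑ i ∈ Finset.range (n + 1), t i * x ^ i → x ∈ T := by
    intro n
    induction n with
    | zero =>
      intro t ht h
      simp only [zero_add, pow_one, Finset.range_one, Finset.sum_singleton, pow_zero, mul_one] at h
      rw [h]; exact ht 0
    | succ n ih =>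
      intro t ht h
      refine ih (fun i => t (i + 1) * (q * x) + (if i = 0 then t 0 * q else 0) +
        (if i = n then p * x else 0)) (fun i => ?_) ?_
      · refine add_mem (add_mem (mul_mem (ht _) hqxT) ?_) ?_
        · split_ifs
          · exact mul_mem (ht 0) hqT
          · exact zero_mem _
        · split_ifs
          · exact hpxT
          · exact zero_mem _
      · simp only [add_mul, Finset.sum_add_distrib, ite_mul, zero_mul, Finset.sum_ite_eq',
          Finset.mem_range, Nat.lt_succ_self, if_true, Nat.succ_pos, pow_zero, mul_one]
        rw [Finset.sum_range_succ'] at h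
        have e1 : ∑ i ∈ Finset.range (n + 1), t (i + 1) * (q * x) * x ^ i =
            q * ∑ i ∈ Finset.range (n + 1), t (i + 1) * x ^ (i + 1) := by
          rw [Finset.mul_sum]
          exact Finset.sum_congr rfl fun i _ => by ring
        rw [e1]
        linear_combination q * h - x ^ (n + 1) * hpq
  obtain ⟨f, hf, hfx⟩ := hx
  rcases hN : f.natDegree with _ | n
  · rw [hf.natDegree_eq_zero.1 hN, Polynomial.eval₂_one] at hfx
    exact absurd hfx one_ne_zero
  · refine descent n (fun i => -(f.coeff i : F)) (fun i => neg_mem (f.coeff i).2) ?_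
    rw [hf.as_sum, hN, Polynomial.eval₂_add, Polynomial.eval₂_finsetSum] at hfx
    simp only [Polynomial.eval₂_pow, Polynomial.eval₂_X, Polynomial.eval₂_mul,
      Polynomial.eval₂_C] at hfx
    simp only [neg_mul, Finset.sum_neg_distrib]
    exact eq_neg_of_add_eq_zero_left hfx

/-- The conductor of a number ring in its normalization is nonzero: the normalization is
`R · 𝓞 F`, and the finitely many generators of `𝓞 F` have a common denominator in `R`. -/
theorem exists_ne_zero_forall_isIntegral_mul_mem (R F : Type*) [CommRing R] [IsDomain R] [Field F]
    [NumberField F] [Algebra R F] [IsFractionRing R F] :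
    ∃ c : R, c ≠ 0 ∧ ∀ x : F, IsIntegral R x →
      ∃ r : R, algebraMap R F r = algebraMap R F c * x := by
  classical
  obtain ⟨s, hs⟩ := (inferInstance : Module.Finite ℤ (NumberField.RingOfIntegers F))
  obtain ⟨c, hc⟩ := IsLocalization.exist_integer_multiples_of_finset (nonZeroDivisors R)
    (s.image (algebraMap (NumberField.RingOfIntegers F) F))
  have hcO : ∀ y : NumberField.RingOfIntegers F,
      ∃ r : R, algebraMap R F r = algebraMap R F c * y := by
    intro y
    have hy : y ∈ Submodule.span ℤ (s : Set (NumberField.RingOfIntegers F)) := hs ▸ trivial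
    induction hy using Submodule.span_induction with
    | mem y hy =>
      obtain ⟨r, hr⟩ := hc (y : F) (Finset.mem_image_of_mem _ hy)
      exact ⟨r, by rw [hr, Algebra.smul_def]⟩
    | zero => exact ⟨0, by simp⟩
    | add y z _ _ hy hz =>
      obtain ⟨r, hr⟩ := hy
      obtain ⟨r', hr'⟩ := hz
      exact ⟨r + r', by rw [map_add, hr, hr', ← mul_add]; rfl⟩
    | smul n y _ hy =>
      obtain ⟨r, hr⟩ := hy
      have e : ((n • y : NumberField.RingOfIntegers F) : F) = n * (y : F) := by simp
      exact ⟨n * r, by rw [map_mul, hr, map_intCast, e]; ring⟩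
  let T : Subalgebra R F := Algebra.adjoin R (integralClosure ℤ F : Set F)
  have hT : ∀ t ∈ T, ∃ r : R, algebraMap R F r = algebraMap R F c * t := by
    intro t ht
    rw [← Subalgebra.mem_toSubmodule, Algebra.adjoin_eq_span] at ht
    have hcl : (Submonoid.closure (integralClosure ℤ F : Set F) : Set F) =
        (integralClosure ℤ F : Set F) :=
      congrArg _ (Submonoid.closure_eq (integralClosure ℤ F).toSubsemiring.toSubmonoid)
    rw [hcl] at ht
    induction ht using Submodule.span_induction with
    | mem y hy => exact hcO ⟨y, hy⟩
    | zero => exact ⟨0, by simp⟩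
    | add y z _ _ hy hz =>
      obtain ⟨r, hr⟩ := hy
      obtain ⟨r', hr'⟩ := hz
      exact ⟨r + r', by rw [map_add, hr, hr', mul_add]⟩
    | smul a y _ hy =>
      obtain ⟨r, hr⟩ := hy
      exact ⟨a * r, by rw [map_mul, hr, Algebra.smul_def]; ring⟩
  refine ⟨c, nonZeroDivisors.ne_zero c.2, fun x hx => hT x ?_⟩
  refine mem_of_isIntegral_of_dedekind_le (D := NumberField.RingOfIntegers F) T
    (fun d => Algebra.subset_adjoin d.2) hx.tower_top

end Conductor

/-! ### The normalization of a number ring -/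

section Normalization

variable {K : Type*} [Field K]

theorem exists_div_eq_of_mem_closure (R : Subring K) {x : K}
    (hx : x ∈ Subfield.closure (R : Set K)) : ∃ a b : R, x = (a : K) / (b : K) := by
  obtain ⟨a, ha, b, hb, rfl⟩ := Subfield.mem_closure_iff.1 hx
  rw [Subring.closure_eq] at ha hb
  exact ⟨⟨a, ha⟩, ⟨b, hb⟩, rfl⟩

theorem isDedekindDomain_normalization [NumberField K] (R : Subring K) :
    IsDedekindDomain (normalization R) := by
  let F := Subfield.closure (R : Set K)
  have hOF : normalization R ≤ F.toSubring := inf_le_right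
  let : Algebra (normalization R) F := (Subring.inclusion hOF).toAlgebra
  have : FaithfulSMul (normalization R) F :=
    (faithfulSMul_iff_algebraMap_injective _ _).2 (Subring.inclusion_injective hOF)
  have : IsFractionRing (normalization R) F := IsFractionRing.of_field _ _ fun z => by
    obtain ⟨a, b, hab⟩ := exists_div_eq_of_mem_closure R z.2
    exact ⟨⟨a, le_normalization R a.2⟩, ⟨b, le_normalization R b.2⟩, Subtype.ext hab⟩
  have hfin := finite_quotient_of_ne_bot (normalization R)
  refine (isDedekindDomain_iff (normalization R) F).2 ⟨inferInstance,
    isNoetherianRing_of_finite_quotients hfin, dimensionLEOne_of_finite_quotients hfin, ?_⟩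
  intro x hx
  let : Algebra R (normalization R) := (Subring.inclusion (le_normalization R)).toAlgebra
  have : IsScalarTower R (normalization R) K := IsScalarTower.of_algebraMap_eq fun _ => rfl
  have : IsScalarTower (normalization R) F K := IsScalarTower.of_algebraMap_eq fun _ => rfl
  have hint : Algebra.IsIntegral R (normalization R) := ⟨fun y => by
    have h1 : IsIntegral R (algebraMap (normalization R) K y) := y.2.1
    exact (isIntegral_algebraMap_iff Subtype.val_injective).1 h1⟩
  have hxK : IsIntegral (normalization R) (x : K) :=
    hx.map (IsScalarTower.toAlgHom (normalization R) F K)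
  exact ⟨⟨x, isIntegral_trans (R := R) _ hxK, x.2⟩, rfl⟩

theorem exists_conductor [NumberField K] (R : Subring K) :
    ∃ c : R, c ≠ 0 ∧ ∀ x : normalization R, ∃ r : R, (r : K) = c * x := by
  let F := Subfield.closure (R : Set K)
  have hRF : R ≤ F.toSubring := Subfield.subset_closure
  let : Algebra R F := (Subring.inclusion hRF).toAlgebra
  have : FaithfulSMul R F :=
    (faithfulSMul_iff_algebraMap_injective _ _).2 (Subring.inclusion_injective hRF)
  have : IsFractionRing R F := IsFractionRing.of_field _ _ fun z => by
    obtain ⟨a, b, hab⟩ := exists_div_eq_of_mem_closure R z.2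
    exact ⟨a, b, Subtype.ext hab⟩
  have : IsScalarTower R F K := IsScalarTower.of_algebraMap_eq fun _ => rfl
  obtain ⟨c, hc0, hc⟩ := exists_ne_zero_forall_isIntegral_mul_mem R F
  refine ⟨c, hc0, fun x => ?_⟩
  have hx : IsIntegral R (algebraMap F K ⟨x, x.2.2⟩) := x.2.1
  obtain ⟨r, hr⟩ := hc ⟨x, x.2.2⟩ ((isIntegral_algebraMap_iff Subtype.val_injective).1 hx)
  exact ⟨r, congrArg Subtype.val hr⟩

end Normalization

end NumberRing

open NumberRing in
theorem mainTheorem2 {K : Type*} [Field K] [NumberField K] (R : Subring K)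
    (hR : ∀ m : Ideal R, m.IsMaximal →
      NumberRing.SuperMultiplicative (NumberRing.addExtendedIdeal R m))
    (I : Ideal R) :
    ∃ a b c : R, I = Ideal.span {a, b, c} := by
  rcases eq_or_ne I ⊥ with rfl | hI
  · exact ⟨0, 0, 0, by simp⟩
  have hfinR := finite_quotient_of_ne_bot R
  have hfinO := finite_quotient_of_ne_bot (normalization R)
  have := isNoetherianRing_of_finite_quotients hfinR
  have := isDedekindDomain_normalization R
  let : Algebra R (normalization R) := (Subring.inclusion (le_normalization R)).toAlgebra
  have hinj : Function.Injective (algebraMap R (normalization R)) :=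
    Subring.inclusion_injective (le_normalization R)
  obtain ⟨c, hc0, hc⟩ := exists_conductor R
  refine exists_eq_span_triple hfinR hI fun m hm hm0 => ?_
  have := hfinR m hm0
  have hM0 : m.map (algebraMap R (normalization R)) ≠ ⊥ := by
    rwa [Ne, Ideal.map_eq_bot_iff_of_injective hinj]
  have := hfinO _ hM0
  have hle : addExtendedIdeal R m ≤ normalization R := by
    rintro _ ⟨r, a, -, rfl⟩
    exact add_mem (le_normalization R r.2) a.2
  have hrank := finrank_quotient_map_le_three hfinO m hM0 (Subring.inclusion hle)
    (Subring.inclusion_injective hle) (fun x => by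
      constructor
      · rintro ⟨⟨_, r, a, ha, rfl⟩, rfl⟩
        exact ⟨r, a, ha, rfl⟩
      · rintro ⟨r, a, ha, rfl⟩
        exact ⟨⟨_, r, a, ha, rfl⟩, rfl⟩) (hR m hm)
  obtain ⟨h1, h2⟩ := relIndex_smul_le_index hfinO m hM0 (c := c)
    (by rwa [Ne, map_eq_zero_iff _ hinj])
    (fun x => (hc x).imp fun r hr => Subtype.ext hr) hinj I hI
  refine ⟨h1, h2.trans ?_⟩
  let := Ideal.Quotient.field m
  have : Module.Finite (R ⧸ m) (normalization R ⧸ m.map (algebraMap R (normalization R))) :=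
    Module.Finite.of_finite
  have hcard : (m.map (algebraMap R (normalization R))).toAddSubgroup.index =
      Nat.card (normalization R ⧸ m.map (algebraMap R (normalization R))) := rfl
  rw [hcard, Module.natCard_eq_pow_finrank (K := R ⧸ m)]
  exact Nat.pow_le_pow_right Nat.card_pos hrank
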